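/- Let $\lambda_R,\lambda_U>0$, $0<r_0<r_1$, $\alpha>2$ and let $M\ge 1$ be an integer. Remote radio heads (RRHs) with $M$ antennas each form a homogeneous Poisson point process $\Psi_R$ of density $\lambda_R$ in $\mathbb R^2$; a user $j^*$ sits at the origin and is served by the RRHs at distance at most $r_1$. Let $\tilde\Psi_R=\{x_i\}_{i\ge 1}$ be the set of RRHs at distance more than $r_1$ from the origin, enumerated measurably, and $r_i=|x_i|$. With each $i$ associate the number $U_i$ of users served by RRH $i$, and with each $(i,j)$ the number $C_{ij}$ of RRHs serving the $j$-th user of RRH $i$, together with power coefficients $Z^{(i,j)}_m$, $m\ge1$, where: - the $U_i$ are i.i.d. Poisson, $\mathbb P(U_i=n)=p_U(n)=\mu_U^n e^{-\mu_U}/n!$, $\mu_U=\lambda_U\pi(r_1^2-r_0^2)$; - the $C_{ij}$ are i.i.d. zero-truncated Poisson, $\mathbb P(C_{ij}=m)=p(m)=\dfrac{\mu_R^m}{m!}\dfrac{e^{-\mu_R}}{1-e^{-\mu_R}}$ for $m\ge 1$, $\mu_R=\lambda_R\pi(r_1^2-r_0^2)$; - $Z^{(i,j)}_m$ is Gamma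 distributed with shape $k_m$ and scale $s_m$, where $k_1=\frac{M^2+2M-1}{2M}$, $s_1=\frac{2M}{M^2+2M-1}$ and $k_m=\frac{Mm-1}{3Mm(m-1)}$, $s_m=\frac{3(m-1)}{m(Mm-1)}$ for $m>1$; the sequences $(Z^{(i,j)}_m)_{m\ge1}$ are independent over $(i,j)$; - the families $(x_i)$, $(U_i)$, $(C_{ij})$, $(Z^{(i,j)}_m)$ are mutually independent. For $n\ge 0$ let $\tilde\Psi_{R,n}=\{x_i: U_i=n\}$ be the set of outer RRHs serving exactly $n$ users, and let $$P_{I_2}=\sum_{i}\sum_{j=1}^{U_i} Z^{(i,j)}_{C_{ij}}\, r_i^{-\alpha}$$ be the outer interference power. Then $\tilde\Psi_R=\bigcup_{n\ge0}\tilde\Psi_{R,n}$ almost surely, and the $\tilde\Psi_{R,n}$ are independent homogeneous Poisson point processes on $\{|x|>r_1\}$ with densities $\lambda_{R,n}=\lambda_R\,p_U(n)$. The series $P_{I_2}$ converges almost surely and defines a random variable whose characteristic function is, for all $t\in\mathbb R$ (with $j=\sqrt{-1}$ in the formula), $$\phi_{P_{I_2}}(t)=\prod_{n=1}^{\infty}\exp\Big\{-2\pi\lambda_{R,n}\int_{r_1}^{\infty}\Big[1-\Big(\sum_{m=1}^{\infty}p(m)\,(1-jt\,r^{-\alpha}s_m)^{-k_m}\Big)^n\Big]\,r\,dr\Big\},$$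 where the sums over $m$ converge, the integrands are integrable and the product converges. -/

import Mathlib

open MeasureTheory ProbabilityTheory
open scoped ENNReal NNReal

namespace CoopNetwork

noncomputable section

/-- The plane in which the network is deployed, with its Euclidean norm. -/
abbrev Plane : Type := EuclideanSpace ℝ (Fin 2)

/-- A random measure `N` is a Poisson point process with intensity measure `Λ`: the number of
points in a measurable set of finite intensity is Poisson distributed with mean `Λ B`, and the
numbers of points in finitely many pairwise disjoint such sets are independent. -/
structure IsPoissonProcess {Ω E : Type*} [MeasurableSpace Ω] [MeasurableSpace E]
    (P : Measure Ω) (N : Ω → Measure E) (Λ : Measure E) : Prop where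
  law : ∀ B : Set E, MeasurableSet B → Λ B ≠ ∞ →
    HasLaw (fun ω => N ω B)
      ((poissonMeasure (Λ B).toNNReal).map (fun k : ℕ => (k : ℝ≥0∞))) P
  indep : ∀ (m : ℕ) (B : Fin m → Set E), (∀ l, MeasurableSet (B l)) → (∀ l, Λ (B l) ≠ ∞) →
    Pairwise (fun l l' => Disjoint (B l) (B l')) →
    iIndepFun (fun l ω => N ω (B l)) P

/-- The intensity measure of a homogeneous process of density `lam` on the region `A`. -/
def homogeneous (lam : ℝ) (A : Set Plane) : Measure Plane :=
  ENNReal.ofReal lam • (volume.restrict A)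

/-- The points at distance more than `r₁` from the central user, which sits at the origin. -/
def outerRegion (r₁ : ℝ) : Set Plane := {x | r₁ < ‖x‖}

/-- Mean number of nodes in a coordination annulus, for nodes of density `lam`. -/
def annulusMean (lam r₀ r₁ : ℝ) : ℝ := lam * Real.pi * (r₁ ^ 2 - r₀ ^ 2)

/-- Poisson probabilities. -/
def poissonProb (μ : ℝ) (n : ℕ) : ℝ := μ ^ n * Real.exp (-μ) / (n.factorial : ℝ)

/-- Zero-truncated Poisson probabilities (used for `m ≥ 1`). -/
def truncPoissonProb (μ : ℝ) (m : ℕ) : ℝ :=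
  μ ^ m / (m.factorial : ℝ) * (Real.exp (-μ) / (1 - Real.exp (-μ)))

/-- The zero-truncated Poisson distribution: a Poisson law conditioned on being nonzero. -/
def truncPoissonMeasure (μ : ℝ) : Measure ℕ :=
  ProbabilityTheory.cond (poissonMeasure μ.toNNReal) {0}ᶜ

/-- Shape `k_m` of the Gamma law of the normalised power coefficient of a user that is served by
`m ≥ 1` radio heads with `M` antennas each. -/
def gammaShape (M m : ℕ) : ℝ :=
  if m = 1 then ((M : ℝ) ^ 2 + 2 * M - 1) / (2 * M)
  else ((M : ℝ) * m - 1) / (3 * M * m * ((m : ℝ) - 1))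

/-- Scale `s_m` of the same Gamma law. -/
def gammaScale (M m : ℕ) : ℝ :=
  if m = 1 then (2 * (M : ℝ)) / ((M : ℝ) ^ 2 + 2 * M - 1)
  else (3 * ((m : ℝ) - 1)) / (m * ((M : ℝ) * m - 1))

/-- The point process with points `X i`. -/
def pointProcess {Ω : Type*} (X : ℕ → Ω → Plane) (ω : Ω) : Measure Plane :=
  Measure.sum (fun i => Measure.dirac (X i ω))

/-- The sub-process of the points `X i` that serve exactly `n` users. -/
def subProcess {Ω : Type*} (X : ℕ → Ω → Plane) (U : ℕ → Ω → ℕ) (n : ℕ) (ω : Ω) :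
    Measure Plane :=
  Measure.sum (fun i : {i : ℕ // U i ω = n} => Measure.dirac (X i ω))

/-- Power received at the origin from the radio head `X i`, which serves `U i` users, its `j`-th
user being served by `C i j` radio heads in total; `Z i j m` is the power coefficient of that user
if it is served by `m` radio heads. -/
def headInterference {Ω : Type*} (α : ℝ) (X : ℕ → Ω → Plane) (U : ℕ → Ω → ℕ)
    (C : ℕ → ℕ → Ω → ℕ) (Z : ℕ → ℕ → ℕ → Ω → ℝ) (ω : Ω) (i : ℕ) : ℝ :=
  ∑ j ∈ Finset.range (U i ω), Z i j (C i j ω) ω * ‖X i ω‖ ^ (-α)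

/-- The outer interference: total power received at the origin from all the `X i`. -/
def outerInterference {Ω : Type*} (α : ℝ) (X : ℕ → Ω → Plane) (U : ℕ → Ω → ℕ)
    (C : ℕ → ℕ → Ω → ℕ) (Z : ℕ → ℕ → ℕ → Ω → ℝ) (ω : Ω) : ℝ :=
  ∑' i, headInterference α X U C Z ω i

/-- The term `p(m) (1 - j t r^{-α} s_m)^{-k_m}`. -/
def mixTerm (M : ℕ) (lamR r₀ r₁ α t r : ℝ) (m : ℕ) : ℂ :=
  (truncPoissonProb (annulusMean lamR r₀ r₁) m : ℂ) *
    (1 - Complex.I * ((t * r ^ (-α) * gammaScale M m : ℝ) : ℂ)) ^ (-(gammaShape M m : ℂ))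

/-- The integrand `[1 - (∑_{m ≥ 1} p(m) (1 - j t r^{-α} s_m)^{-k_m})^n] r`. -/
def outerIntegrand (M : ℕ) (lamR r₀ r₁ α t : ℝ) (n : ℕ) (r : ℝ) : ℂ :=
  (1 - (∑' m : ℕ+, mixTerm M lamR r₀ r₁ α t r (m : ℕ)) ^ n) * (r : ℂ)

end

end CoopNetwork

namespace CoopNetwork

open Filter Topology

section

theorem norm_prod_sub_prod_le_sum {ι : Type*} (s : Finset ι) {f g : ι → ℂ}
    (hf : ∀ i, ‖f i‖ ≤ 1) (hg : ∀ i, ‖g i‖ ≤ 1) :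
    ‖∏ i ∈ s, f i - ∏ i ∈ s, g i‖ ≤ ∑ i ∈ s, ‖f i - g i‖ := by
  classical
  induction s using Finset.induction_on with
  | empty => simp
  | insert a s ha ih =>
    rw [Finset.prod_insert ha, Finset.prod_insert ha, Finset.sum_insert ha]
    have h1 : ‖∏ i ∈ s, g i‖ ≤ 1 := by
      rw [norm_prod]
      exact Finset.prod_le_one (fun _ _ => norm_nonneg _) fun i _ => hg i
    calc ‖f a * ∏ i ∈ s, f i - g a * ∏ i ∈ s, g i‖
        = ‖f a * (∏ i ∈ s, f i - ∏ i ∈ s, g i) + (f a - g a) * ∏ i ∈ s, g i‖ := by ring_nf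
      _ ≤ ‖f a‖ * ‖∏ i ∈ s, f i - ∏ i ∈ s, g i‖ + ‖f a - g a‖ * ‖∏ i ∈ s, g i‖ := by
          refine (norm_add_le _ _).trans ?_
          rw [norm_mul, norm_mul]
      _ ≤ 1 * (∑ i ∈ s, ‖f i - g i‖) + ‖f a - g a‖ * 1 := by
          gcongr
          exact hf a
      _ = _ := by ring

theorem norm_prod_le_one {ι : Type*} (s : Finset ι) {f : ι → ℂ} (hf : ∀ i, ‖f i‖ ≤ 1) :
    ‖∏ i ∈ s, f i‖ ≤ 1 := by
  rw [norm_prod]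
  exact Finset.prod_le_one (fun _ _ => norm_nonneg _) fun i _ => hf i

theorem lintegral_natCast_poissonMeasure (r : ℝ≥0) :
    ∫⁻ k : ℕ, (k : ℝ≥0∞) ∂(poissonMeasure r) = r := by
  rw [lintegral_countable']
  simp_rw [poissonMeasure_singleton]
  rw [tsum_eq_zero_add' ENNReal.summable]
  have h (n : ℕ) : ((n + 1 : ℕ) : ℝ≥0∞) *
      ENNReal.ofReal (Real.exp (-r) * r ^ (n + 1) / (n + 1).factorial)
      = r * ENNReal.ofReal (Real.exp (-r) * r ^ n / n.factorial) := by
    rw [← ENNReal.ofReal_natCast, ← ENNReal.ofReal_mul (by positivity),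
      ← ENNReal.ofReal_coe_nnreal, ← ENNReal.ofReal_mul (by positivity)]
    congr 1
    rw [Nat.factorial_succ]
    push_cast
    field_simp
    ring
  simp_rw [h]
  rw [ENNReal.tsum_mul_left, ← ENNReal.ofReal_tsum_of_nonneg (fun n => by positivity)
    (hasSum_one_poissonMeasure r).summable, (hasSum_one_poissonMeasure r).tsum_eq]
  simp

theorem integral_pow_poissonMeasure (r : ℝ≥0) (z : ℂ) :
    ∫ k : ℕ, z ^ k ∂(poissonMeasure r) = Complex.exp (r * (z - 1)) := by
  rw [integral_poissonMeasure]
  have h (n : ℕ) : (Real.exp (-r) * r ^ n / n.factorial : ℝ) • z ^ n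
      = Complex.exp (-r) * ((r * z) ^ n / n.factorial) := by
    rw [Complex.real_smul]
    push_cast
    rw [mul_pow]
    ring
  simp_rw [h]
  rw [tsum_mul_left, (NormedSpace.expSeries_div_hasSum_exp (r * z : ℂ)).tsum_eq,
    ← Complex.exp_eq_exp_ℂ, ← Complex.exp_add]
  congr 1
  ring

variable {Ω E : Type*} [MeasurableSpace Ω] [MeasurableSpace E] {P : Measure Ω}

theorem IsPoissonProcess.indep_fintype {N : Ω → Measure E} {Λ : Measure E}
    (hN : IsPoissonProcess P N Λ) {ι : Type*} [Fintype ι] (B : ι → Set E)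
    (hB : ∀ l, MeasurableSet (B l)) (hfin : ∀ l, Λ (B l) ≠ ∞)
    (hdisj : Pairwise fun l l' => Disjoint (B l) (B l')) :
    iIndepFun (fun l ω => N ω (B l)) P := by
  let e := (Fintype.equivFin ι).symm
  have := hN.indep _ (fun l => B (e l)) (fun l => hB _) (fun l => hfin _)
    (fun l l' h => hdisj (e.injective.ne h))
  exact this.of_precomp e.surjective

theorem IsPoissonProcess.congr {N N' : Ω → Measure E} {Λ : Measure E}
    (hN : IsPoissonProcess P N Λ) (h : ∀ᵐ ω ∂P, N ω = N' ω) : IsPoissonProcess P N' Λ where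
  law B hB hfin := (hN.law B hB hfin).congr (by filter_upwards [h] with ω hω; rw [hω])
  indep m B hB hfin hd := by
    refine (iIndepFun_congr fun l => ?_).1 (hN.indep m B hB hfin hd)
    filter_upwards [h] with ω hω
    rw [hω]

theorem IsPoissonProcess.restrict {N : Ω → Measure E} {Λ : Measure E}
    (hN : IsPoissonProcess P N Λ) {A : Set E} (hA : MeasurableSet A) :
    IsPoissonProcess P (fun ω => (N ω).restrict A) (Λ.restrict A) where
  law B hB hfin := by
    simp only [Measure.restrict_apply hB] at hfin ⊢
    exact hN.law _ (hB.inter hA) hfin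
  indep m B hB hfin hd := by
    simp only [Measure.restrict_apply (hB _)] at hfin ⊢
    exact hN.indep m _ (fun l => (hB l).inter hA) hfin
      (fun l l' h => (hd h).mono Set.inter_subset_left Set.inter_subset_left)

variable {X : ℕ → Ω → E} {Λ : Measure E}

theorem IsPoissonProcess.lintegral_apply {N : Ω → Measure E} (hN : IsPoissonProcess P N Λ)
    {B : Set E} (hB : MeasurableSet B) (hfin : Λ B ≠ ∞) : ∫⁻ ω, N ω B ∂P = Λ B := by
  have h := hN.law B hB hfin
  calc ∫⁻ ω, N ω B ∂P = ∫⁻ x, x ∂(P.map fun ω => N ω B) :=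
        (lintegral_map' aemeasurable_id h.aemeasurable).symm
    _ = _ := by
        rw [h.map_eq, lintegral_map (f := fun x => x) measurable_id .of_discrete,
          lintegral_natCast_poissonMeasure, ENNReal.coe_toNNReal hfin]

/-- Campbell's formula. -/
theorem IsPoissonProcess.tsum_lintegral [SigmaFinite Λ] (hX : ∀ i, Measurable (X i))
    (hN : IsPoissonProcess P (fun ω => Measure.sum fun i => Measure.dirac (X i ω)) Λ)
    {f : E → ℝ≥0∞} (hf : Measurable f) :
    ∑' i, ∫⁻ ω, f (X i ω) ∂P = ∫⁻ x, f x ∂Λ := by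
  have key : Measure.sum (fun i => P.map (X i)) = Λ := by
    refine (Measure.ext_iff_of_iUnion_eq_univ (iUnion_spanningSets Λ)).2 fun k => ?_
    ext B hB
    have hk := measurableSet_spanningSets Λ k
    rw [Measure.restrict_apply hB, Measure.restrict_apply hB,
      ← hN.lintegral_apply (hB.inter hk)
        ((measure_mono Set.inter_subset_right).trans_lt (measure_spanningSets_lt_top Λ k)).ne,
      Measure.sum_apply _ (hB.inter hk)]
    simp_rw [Measure.sum_apply _ (hB.inter hk)]
    rw [lintegral_tsum]
    · refine tsum_congr fun i => ?_
      rw [Measure.map_apply (hX i) (hB.inter hk), ← lintegral_indicator_one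
        (hX i (hB.inter hk))]
      refine lintegral_congr fun ω => ?_
      rw [Measure.dirac_apply' _ (hB.inter hk)]
      rfl
    · intro i
      exact ((Measure.measurable_coe (hB.inter hk)).comp
        (Measure.measurable_dirac.comp (hX i))).aemeasurable
  rw [← key, lintegral_sum_measure]
  exact tsum_congr fun i => (lintegral_map hf (hX i)).symm

/-- If finitely many points of a sequence lie in `B`, the partial counts eventually agree with the
total count. -/
theorem eventually_card_filter_eq {x : ℕ → E} {B : Set E} [DecidablePred (· ∈ B)]
    (hB : MeasurableSet B) (hfin : Measure.sum (fun i => Measure.dirac (x i)) B ≠ ∞) :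
    ∀ᶠ n in atTop, (((Finset.range n).filter fun i => x i ∈ B).card : ℝ≥0∞)
      = Measure.sum (fun i => Measure.dirac (x i)) B := by
  have hs : Measure.sum (fun i => Measure.dirac (x i)) B
      = ∑' i, {i | x i ∈ B}.indicator (fun _ => (1 : ℝ≥0∞)) i := by
    rw [Measure.sum_apply _ hB]
    refine tsum_congr fun i => ?_
    rw [Measure.dirac_apply' _ hB]
    rfl
  have hf : {i | x i ∈ B}.Finite := by
    rw [hs] at hfin
    refine (ENNReal.finite_const_le_of_tsum_ne_top hfin one_ne_zero).subset fun i hi => ?_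
    simp only [Set.mem_ofPred_eq] at hi ⊢
    simp [hi]
  obtain ⟨b, hb⟩ := hf.bddAbove
  filter_upwards [eventually_gt_atTop b] with n hn
  rw [hs, tsum_eq_sum (s := Finset.range n)]
  · simp [Set.indicator_apply]
  · intro i hi
    have : i ∉ {i | x i ∈ B} := fun h => by
      have := hb h
      simp at hi
      omega
    simp [Set.indicator_of_notMem this]

theorem IsPoissonProcess.integral_pow {N : Ω → Measure E} (hN : IsPoissonProcess P N Λ)
    {B : Set E} (hB : MeasurableSet B) (hfin : Λ B ≠ ∞) (z : ℂ) :
    ∫ ω, z ^ ⌊(N ω B).toReal⌋₊ ∂P = Complex.exp (Λ.real B * (z - 1)) := by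
  have h := hN.law B hB hfin
  have hm : Measurable fun x : ℝ≥0∞ => z ^ ⌊x.toReal⌋₊ :=
    (Measurable.of_discrete (f := fun k : ℕ => z ^ k)).comp
      (Nat.measurable_floor.comp ENNReal.measurable_toReal)
  calc ∫ ω, z ^ ⌊(N ω B).toReal⌋₊ ∂P
      = ∫ x, z ^ ⌊x.toReal⌋₊ ∂(P.map fun ω => N ω B) :=
        (integral_map h.aemeasurable hm.aestronglyMeasurable).symm
    _ = _ := by
        rw [h.map_eq, integral_map .of_discrete hm.aestronglyMeasurable]
        simp only [ENNReal.toReal_natCast, Nat.floor_natCast]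
        rw [integral_pow_poissonMeasure]
        rfl

theorem IsPoissonProcess.ae_ne_top {N : Ω → Measure E} (hN : IsPoissonProcess P N Λ)
    {B : Set E} (hB : MeasurableSet B) (hfin : Λ B ≠ ∞) : ∀ᵐ ω ∂P, N ω B ≠ ∞ := by
  have h := ae_lt_top' (hN.law B hB hfin).aemeasurable
    (by rw [hN.lintegral_apply hB hfin]; exact hfin)
  filter_upwards [h] with ω hω using hω.ne

variable [IsProbabilityMeasure P]

theorem IsPoissonProcess.tendsto_integral_prod_simpleFunc (hX : ∀ i, Measurable (X i))
    (hN : IsPoissonProcess P (fun ω => Measure.sum fun i => Measure.dirac (X i ω)) Λ)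
    (F : SimpleFunc E ℂ) (hF : ∀ x, ‖F x‖ ≤ 1) (hint : Integrable (fun x => F x - 1) Λ) :
    Tendsto (fun n => ∫ ω, ∏ i ∈ Finset.range n, F (X i ω) ∂P) atTop
      (𝓝 (Complex.exp (∫ x, (F x - 1) ∂Λ))) := by
  classical
  set S : Finset ℂ := F.range.erase 1 with hS
  set N : Ω → Measure E := fun ω => Measure.sum fun i => Measure.dirac (X i ω) with hNdef
  have hBm (c : ℂ) : MeasurableSet (F ⁻¹' {c}) := F.measurableSet_fiber c
  have hBfin (c : S) : Λ (F ⁻¹' {(c : ℂ)}) ≠ ∞ := by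
    have hc : (c : ℂ) ≠ 1 := (Finset.mem_erase.1 c.2).1
    refine ne_top_of_le_ne_top (hint.measure_norm_ge_lt_top
      (norm_pos_iff.2 (sub_ne_zero.2 hc))).ne (measure_mono ?_)
    intro x hx
    simp only [Set.mem_preimage, Set.mem_singleton_iff] at hx
    simp [hx]
  have hFval (x : E) : F x = ∏ c ∈ S, c ^ (if F x = c then 1 else 0) := by
    by_cases h : F x = 1
    · rw [h, Finset.prod_eq_one]
      intro c hc
      rw [if_neg (Finset.mem_erase.1 hc).1.symm, pow_zero]
    · rw [Finset.prod_eq_single (F x)]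
      · simp
      · intro b _ hb
        rw [if_neg hb.symm, pow_zero]
      · intro hn
        exact absurd (Finset.mem_erase.2 ⟨h, F.mem_range_self x⟩) hn
  have hprod (n : ℕ) (ω : Ω) : ∏ i ∈ Finset.range n, F (X i ω)
      = ∏ c ∈ S, c ^ ((Finset.range n).filter fun i => X i ω ∈ F ⁻¹' {c}).card := by
    conv_lhs => enter [2, i]; rw [hFval]
    rw [Finset.prod_comm]
    refine Finset.prod_congr rfl fun c _ => ?_
    rw [Finset.prod_pow_eq_pow_sum, Finset.card_filter]
    rfl
  have hlim : Tendsto (fun n => ∫ ω, ∏ i ∈ Finset.range n, F (X i ω) ∂P) atTop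
      (𝓝 (∫ ω, ∏ c : S, (c : ℂ) ^ ⌊(N ω (F ⁻¹' {(c : ℂ)})).toReal⌋₊ ∂P)) := by
    refine tendsto_integral_of_dominated_convergence (fun _ => 1) (fun n => ?_)
      (integrable_const 1) (fun n => ae_of_all _ fun ω => norm_prod_le_one _ fun i => hF _) ?_
    · exact (Finset.measurable_fun_prod _ fun i _ =>
        F.measurable.comp (hX i)).aestronglyMeasurable
    · have hae : ∀ᵐ ω ∂P, ∀ c : S, N ω (F ⁻¹' {(c : ℂ)}) ≠ ∞ :=
        ae_all_iff.2 fun c => hN.ae_ne_top (hBm _) (hBfin c)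
      filter_upwards [hae] with ω hω
      refine tendsto_const_nhds.congr' ?_
      have := eventually_all.2 fun c : S => eventually_card_filter_eq (hBm c) (hω c)
      filter_upwards [this] with n hn
      rw [hprod, ← Finset.prod_coe_sort S]
      refine Finset.prod_congr rfl fun c _ => ?_
      have := hn c
      simp only [hNdef]
      rw [← this]
      simp
  convert hlim using 2
  have hind := (hN.indep_fintype (fun c : S => F ⁻¹' {(c : ℂ)}) (fun c => hBm c) hBfin
    (fun c c' h => Set.disjoint_left.2 fun x hx hx' =>
      h (Subtype.ext (hx.symm.trans hx'))))
  have hm (c : S) : Measurable fun x : ℝ≥0∞ => (c : ℂ) ^ ⌊x.toReal⌋₊ :=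
    (Measurable.of_discrete (f := fun k : ℕ => (c : ℂ) ^ k)).comp
      (Nat.measurable_floor.comp ENNReal.measurable_toReal)
  rw [hind.integral_fun_prod_comp (f := fun (c : S) x => (c : ℂ) ^ ⌊x.toReal⌋₊)
    (fun c => (hN.law _ (hBm c) (hBfin c)).aemeasurable)
    (fun c => (hm c).aestronglyMeasurable)]
  simp_rw [hN.integral_pow (hBm _) (hBfin _)]
  rw [← Complex.exp_sum]
  congr 1
  have hsum (x : E) : F x - 1 = ∑ c : S, (F ⁻¹' {(c : ℂ)}).indicator (fun _ => (c : ℂ) - 1) x := by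
    rw [Finset.sum_coe_sort S (fun c => (F ⁻¹' {(c : ℂ)}).indicator (fun _ => (c : ℂ) - 1) x)]
    by_cases h : F x = 1
    · rw [h, sub_self, Finset.sum_eq_zero]
      intro c hc
      refine Set.indicator_of_notMem ?_ _
      intro hx
      exact (Finset.mem_erase.1 hc).1 (hx.symm.trans h)
    · rw [Finset.sum_eq_single (F x)]
      · rw [Set.indicator_of_mem]
        rfl
      · intro b _ hb
        refine Set.indicator_of_notMem ?_ _
        exact fun hx => hb hx.symm
      · intro hn
        exact absurd (Finset.mem_erase.2 ⟨h, F.mem_range_self x⟩) hn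
  simp_rw [hsum]
  rw [integral_finsetSum]
  · refine Finset.sum_congr rfl fun c _ => ?_
    rw [integral_indicator_const _ (hBm c), Complex.real_smul]
  · intro c _
    exact (integrable_indicator_iff (hBm c)).2 (integrableOn_const (hBfin c))

/-- The probability generating functional of a Poisson process. -/
theorem IsPoissonProcess.tendsto_integral_prod [SigmaFinite Λ] (hX : ∀ i, Measurable (X i))
    (hN : IsPoissonProcess P (fun ω => Measure.sum fun i => Measure.dirac (X i ω)) Λ)
    {F : E → ℂ} (hFm : Measurable F) (hF : ∀ x, ‖F x‖ ≤ 1)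
    (hint : Integrable (fun x => F x - 1) Λ) :
    Tendsto (fun n => ∫ ω, ∏ i ∈ Finset.range n, F (X i ω) ∂P) atTop
      (𝓝 (Complex.exp (∫ x, (F x - 1) ∂Λ))) := by
  have h1 : (1 : ℂ) ∈ Metric.closedBall (0 : ℂ) 1 := by simp
  set G : ℕ → SimpleFunc E ℂ := SimpleFunc.approxOn F hFm (Metric.closedBall 0 1) 1 h1 with hG
  have hGF : Tendsto (fun k => ∫⁻ x, ‖G k x - F x‖ₑ ∂Λ) atTop (𝓝 0) :=
    SimpleFunc.tendsto_approxOn_L1_enorm hFm h1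
      (ae_of_all _ fun x => subset_closure (by simpa using hF x)) hint.2
  have hGb (k : ℕ) (x : E) : ‖G k x‖ ≤ 1 := by
    simpa using SimpleFunc.approxOn_mem hFm h1 k x
  have hGint (k : ℕ) : Integrable (fun x => G k x - 1) Λ := by
    refine Integrable.mono' (hint.norm.add hint.norm)
      ((G k).measurable.sub_const 1).aestronglyMeasurable (ae_of_all _ fun x => ?_)
    exact SimpleFunc.norm_approxOn_y₀_le hFm h1 x k
  have hGdiff (k : ℕ) : Integrable (fun x => G k x - F x) Λ := by
    refine ((hGint k).sub hint).congr (ae_of_all _ fun x => ?_)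
    simp
  have hexp : Tendsto (fun k => Complex.exp (∫ x, (G k x - 1) ∂Λ)) atTop
      (𝓝 (Complex.exp (∫ x, (F x - 1) ∂Λ))) := by
    refine (Complex.continuous_exp.tendsto _).comp ?_
    refine tendsto_integral_of_L1 _ hint.1 (Eventually.of_forall hGint) ?_
    simpa using hGF
  have hunif (k n : ℕ) : ‖(∫ ω, ∏ i ∈ Finset.range n, F (X i ω) ∂P)
      - ∫ ω, ∏ i ∈ Finset.range n, G k (X i ω) ∂P‖ₑ ≤ ∫⁻ x, ‖G k x - F x‖ₑ ∂Λ := by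
    have hi1 : Integrable (fun ω => ∏ i ∈ Finset.range n, F (X i ω)) P :=
      Integrable.of_bound (Finset.measurable_fun_prod _ fun i _ =>
        hFm.comp (hX i)).aestronglyMeasurable 1
        (ae_of_all _ fun ω => norm_prod_le_one _ fun i => hF _)
    have hi2 : Integrable (fun ω => ∏ i ∈ Finset.range n, G k (X i ω)) P :=
      Integrable.of_bound (Finset.measurable_fun_prod _ fun i _ =>
        (G k).measurable.comp (hX i)).aestronglyMeasurable 1
        (ae_of_all _ fun ω => norm_prod_le_one _ fun i => hGb k _)
    rw [← integral_sub hi1 hi2]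
    have hme : Measurable fun x => ‖G k x - F x‖ₑ := ((G k).measurable.sub hFm).enorm
    refine (enorm_integral_le_lintegral_enorm _).trans ?_
    calc ∫⁻ ω, ‖∏ i ∈ Finset.range n, F (X i ω) - ∏ i ∈ Finset.range n, G k (X i ω)‖ₑ ∂P
        ≤ ∫⁻ ω, ∑ i ∈ Finset.range n, ‖G k (X i ω) - F (X i ω)‖ₑ ∂P := by
          refine lintegral_mono fun ω => ?_
          rw [← ofReal_norm]
          simp_rw [← ofReal_norm]
          rw [← ENNReal.ofReal_sum_of_nonneg fun _ _ => norm_nonneg _]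
          refine ENNReal.ofReal_le_ofReal ?_
          simp_rw [norm_sub_rev (G k _)]
          exact norm_prod_sub_prod_le_sum _ (fun i => hF _) fun i => hGb k _
      _ = ∑ i ∈ Finset.range n, ∫⁻ ω, ‖G k (X i ω) - F (X i ω)‖ₑ ∂P :=
          lintegral_finsetSum _ fun i _ => hme.comp (hX i)
      _ ≤ ∑' i, ∫⁻ ω, ‖G k (X i ω) - F (X i ω)‖ₑ ∂P := ENNReal.sum_le_tsum _
      _ = _ := hN.tsum_lintegral hX hme
  rw [EMetric.tendsto_atTop]
  intro ε hε
  have hε3 : (0 : ℝ≥0∞) < ε / 3 := ENNReal.div_pos hε.ne' (by simp)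
  obtain ⟨k, hk1, hk2⟩ := ((hGF.eventually (gt_mem_nhds hε3)).and
    (EMetric.tendsto_nhds.1 hexp (ε / 3) hε3)).exists
  obtain ⟨n₀, hn₀⟩ := EMetric.tendsto_atTop.1
    (hN.tendsto_integral_prod_simpleFunc hX (G k) (hGb k) (hGint k)) (ε / 3) hε3
  refine ⟨n₀, fun n hn => ?_⟩
  have h3 := hunif k n
  rw [← edist_eq_enorm_sub] at h3
  calc edist _ _ ≤ edist _ _ + edist _ _ + edist _ _ := edist_triangle4 _ _ _ _
    _ < ε / 3 + ε / 3 + ε / 3 :=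
        ENNReal.add_lt_add (ENNReal.add_lt_add (h3.trans_lt hk1) (hn₀ n hn)) hk2
    _ = ε := ENNReal.add_thirds ε

end

section

variable {Ω E : Type*} [MeasurableSpace Ω] [MeasurableSpace E] {P : Measure Ω}

/-- Two independent families of independent random variables form an independent family of
pairs. -/
theorem iIndepFun_prodMk {ι α β : Type*} [MeasurableSpace α] [MeasurableSpace β]
    {U : ι → Ω → α} {V : ι → Ω → β} (mU : ∀ i, Measurable (U i)) (mV : ∀ i, Measurable (V i))
    (hU : iIndepFun U P) (hV : iIndepFun V P)
    (hUV : IndepFun (fun ω i => U i ω) (fun ω i => V i ω) P) :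
    iIndepFun (fun i ω => (U i ω, V i ω)) P := by
  rw [iIndepFun_iff_iIndep]
  let π (i : ι) : Set (Set Ω) := {s | ∃ t ∈ Set.image2 (fun (x : Set α) (y : Set β) => x ×ˢ y)
    {s | MeasurableSet s} {t | MeasurableSet t}, (fun ω => (U i ω, V i ω)) ⁻¹' t = s}
  refine iIndepSets.iIndep (fun i => ((mU i).prodMk (mV i)).comap_le) π
    (fun i => isPiSystem_prod.comap _) (fun i => ?_) ?_
  · rw [← generateFrom_prod, MeasurableSpace.comap_generateFrom]
    rfl
  · rw [iIndepSets_iff]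
    intro s f hf
    have hex (i : ι) : ∃ A : Set α, ∃ B : Set β, MeasurableSet A ∧ MeasurableSet B ∧
        (i ∈ s → f i = U i ⁻¹' A ∩ V i ⁻¹' B) := by
      by_cases hi : i ∈ s
      · obtain ⟨t, ⟨A, hA, B, hB, rfl⟩, ht⟩ := hf i hi
        exact ⟨A, B, hA, hB, fun _ => ht.symm⟩
      · exact ⟨∅, ∅, .empty, .empty, fun h => absurd h hi⟩
    choose A B hA hB hfAB using hex
    have hsplit : (⋂ i ∈ s, f i) = (⋂ i ∈ s, U i ⁻¹' A i) ∩ ⋂ i ∈ s, V i ⁻¹' B i := by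
      rw [Set.iInter₂_congr fun i hi => hfAB i hi]
      simp_rw [Set.iInter_inter_distrib]
    have h1 : P ((⋂ i ∈ s, U i ⁻¹' A i) ∩ ⋂ i ∈ s, V i ⁻¹' B i)
        = P (⋂ i ∈ s, U i ⁻¹' A i) * P (⋂ i ∈ s, V i ⁻¹' B i) := by
      have e1 : (⋂ i ∈ s, U i ⁻¹' A i)
          = (fun ω i => U i ω) ⁻¹' (Set.pi (s : Set ι) A) := by
        ext ω; simp [Set.mem_pi]
      have e2 : (⋂ i ∈ s, V i ⁻¹' B i)
          = (fun ω i => V i ω) ⁻¹' (Set.pi (s : Set ι) B) := by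
        ext ω; simp [Set.mem_pi]
      rw [e1, e2]
      exact hUV.measure_inter_preimage_eq_mul _ _
        (MeasurableSet.pi s.countable_toSet fun i _ => hA i)
        (MeasurableSet.pi s.countable_toSet fun i _ => hB i)
    rw [hsplit, h1, hU.measure_inter_preimage_eq_mul s fun i _ => hA i,
      hV.measure_inter_preimage_eq_mul s fun i _ => hB i, ← Finset.prod_mul_distrib]
    refine Finset.prod_congr rfl fun i hi => ?_
    rw [hfAB i hi]
    symm
    exact (hUV.comp (measurable_pi_apply i)
      (measurable_pi_apply i)).measure_inter_preimage_eq_mul _ _ (hA i) (hB i)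

/-- Rows of an independent array are independent. -/
theorem iIndepFun_curry {ι κ α : Type*} [MeasurableSpace α] [IsProbabilityMeasure P]
    {V : ι × κ → Ω → α} (mV : ∀ q, Measurable (V q)) (hV : iIndepFun V P) :
    iIndepFun (fun i ω j => V (i, j) ω) P := by
  have hp (q : ι × κ) : IsProbabilityMeasure (P.map (V q)) :=
    Measure.isProbabilityMeasure_map (mV q).aemeasurable
  have hrow (i : ι) : P.map (fun ω j => V (i, j) ω)
      = Measure.infinitePi fun j => P.map (V (i, j)) := by
    refine (hV.precomp (g := fun j => (i, j)) ?_).map_fun_eq_infinitePi_map fun j => mV _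
    exact fun j j' h => (Prod.ext_iff.1 h).2
  rw [iIndepFun_iff_map_fun_eq_infinitePi_map fun i => measurable_pi_lambda _ fun j => mV _]
  simp_rw [hrow]
  rw [← Measure.infinitePi_map_curry (fun i j => P.map (V (i, j))),
    ← hV.map_fun_eq_infinitePi_map mV, Measure.map_map (MeasurableEquiv.measurable _)
      (measurable_pi_lambda _ mV)]
  rfl

variable [IsProbabilityMeasure P]

section Marked

variable {K : Type*} [MeasurableSpace K] {X : ℕ → Ω → E} {Y : ℕ → Ω → K} {Λ : Measure E}

theorem integral_prod_marked (hX : ∀ i, Measurable (X i)) (hY : ∀ i, Measurable (Y i))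
    (hYind : iIndepFun Y P) (hXY : IndepFun (fun ω i => X i ω) (fun ω i => Y i ω) P)
    {h : E → K → ℂ} (hm : Measurable (Function.uncurry h)) (hb : ∀ x y, ‖h x y‖ ≤ 1)
    {H : E → ℂ} (hH : ∀ i x, ∫ ω, h x (Y i ω) ∂P = H x) (n : ℕ) :
    ∫ ω, ∏ i ∈ Finset.range n, h (X i ω) (Y i ω) ∂P
      = ∫ ω, ∏ i ∈ Finset.range n, H (X i ω) ∂P := by
  have mX : Measurable fun ω i => X i ω := measurable_pi_lambda _ hX
  have mY : Measurable fun ω i => Y i ω := measurable_pi_lambda _ hY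
  have mg : Measurable fun q : (ℕ → E) × (ℕ → K) => ∏ i ∈ Finset.range n, h (q.1 i) (q.2 i) := by
    refine Finset.measurable_fun_prod _ fun i _ => ?_
    have m1 : Measurable fun q : (ℕ → E) × (ℕ → K) => q.1 i := by fun_prop
    have m2 : Measurable fun q : (ℕ → E) × (ℕ → K) => q.2 i := by fun_prop
    exact hm.comp (m1.prodMk m2)
  have hlaw := (indepFun_iff_map_prod_eq_prod_map_map mX.aemeasurable mY.aemeasurable).1 hXY
  have : IsProbabilityMeasure (P.map fun ω i => X i ω) :=
    Measure.isProbabilityMeasure_map mX.aemeasurable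
  have : IsProbabilityMeasure (P.map fun ω i => Y i ω) :=
    Measure.isProbabilityMeasure_map mY.aemeasurable
  have hHm : Measurable H := by
    have : StronglyMeasurable fun x => ∫ ω, h x (Y 0 ω) ∂P := by
      refine StronglyMeasurable.integral_prod_right (f := fun x ω => h x (Y 0 ω)) ?_
      exact (hm.comp (measurable_fst.prodMk ((hY 0).comp measurable_snd))).stronglyMeasurable
    simp_rw [hH] at this
    exact this.measurable
  calc ∫ ω, ∏ i ∈ Finset.range n, h (X i ω) (Y i ω) ∂P
      = ∫ q, ∏ i ∈ Finset.range n, h (q.1 i) (q.2 i)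
          ∂(P.map fun ω => ((fun i => X i ω), fun i => Y i ω)) :=
        (integral_map (mX.prodMk mY).aemeasurable mg.aestronglyMeasurable).symm
    _ = ∫ x, ∫ y, ∏ i ∈ Finset.range n, h (x i) (y i)
          ∂(P.map fun ω i => Y i ω) ∂(P.map fun ω i => X i ω) := by
        rw [hlaw, integral_prod]
        exact Integrable.of_bound mg.aestronglyMeasurable 1
          (ae_of_all _ fun q => norm_prod_le_one _ fun i => hb _ _)
    _ = ∫ x, ∏ i ∈ Finset.range n, H (x i) ∂(P.map fun ω i => X i ω) := by
        refine integral_congr_ae (ae_of_all _ fun x => ?_)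
        have mx (i : ℕ) : Measurable (h (x i)) := hm.comp measurable_prodMk_left
        have : Measurable fun y : ℕ → K => ∏ i ∈ Finset.range n, h (x i) (y i) :=
          Finset.measurable_fun_prod _ fun i _ => (mx i).comp (measurable_pi_apply i)
        simp only
        rw [integral_map mY.aemeasurable this.aestronglyMeasurable]
        simp_rw [← Finset.prod_coe_sort (Finset.range n)]
        have hYn : iIndepFun (fun i : Finset.range n => Y i) P :=
          hYind.precomp Subtype.val_injective
        rw [hYn.integral_fun_prod_comp (f := fun (i : Finset.range n) => h (x i))
          (fun i => (hY i).aemeasurable) fun i => (mx i).aestronglyMeasurable]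
        exact Finset.prod_congr rfl fun i _ => hH _ _
    _ = _ := by
        refine integral_map mX.aemeasurable (Measurable.aestronglyMeasurable ?_)
        exact Finset.measurable_fun_prod _ fun i _ => hHm.comp (measurable_pi_apply i)

/-- The probability generating functional of an independently marked Poisson process. -/
theorem IsPoissonProcess.tendsto_integral_prod_marked [SigmaFinite Λ]
    (hX : ∀ i, Measurable (X i))
    (hN : IsPoissonProcess P (fun ω => Measure.sum fun i => Measure.dirac (X i ω)) Λ)
    (hY : ∀ i, Measurable (Y i)) (hYind : iIndepFun Y P)
    (hXY : IndepFun (fun ω i => X i ω) (fun ω i => Y i ω) P)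
    {h : E → K → ℂ} (hm : Measurable (Function.uncurry h)) (hb : ∀ x y, ‖h x y‖ ≤ 1)
    {H : E → ℂ} (hH : ∀ i x, ∫ ω, h x (Y i ω) ∂P = H x)
    (hint : Integrable (fun x => H x - 1) Λ) :
    Tendsto (fun n => ∫ ω, ∏ i ∈ Finset.range n, h (X i ω) (Y i ω) ∂P) atTop
      (𝓝 (Complex.exp (∫ x, (H x - 1) ∂Λ))) := by
  simp_rw [integral_prod_marked hX hY hYind hXY hm hb hH]
  refine hN.tendsto_integral_prod hX ?_ (fun x => ?_) hint
  · have : StronglyMeasurable fun x => ∫ ω, h x (Y 0 ω) ∂P := by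
      refine StronglyMeasurable.integral_prod_right (f := fun x ω => h x (Y 0 ω)) ?_
      exact (hm.comp (measurable_fst.prodMk ((hY 0).comp measurable_snd))).stronglyMeasurable
    simp_rw [hH] at this
    exact this.measurable
  · rw [← hH 0 x]
    simpa using norm_integral_le_of_norm_le_const (μ := P) (ae_of_all _ fun ω => hb x (Y 0 ω))

end Marked

end

section

variable {Ω : Type*} {X : ℕ → Ω → Plane} {U : ℕ → Ω → ℕ}

theorem subProcess_apply (n : ℕ) (ω : Ω) {B : Set Plane} (hB : MeasurableSet B) :
    subProcess X U n ω B = Measure.sum (fun i => Measure.dirac (X i ω, U i ω)) (B ×ˢ {n}) := by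
  have hBn : MeasurableSet (B ×ˢ ({n} : Set ℕ)) := hB.prod (measurableSet_singleton n)
  rw [subProcess, Measure.sum_apply _ hB, Measure.sum_apply _ hBn]
  refine (tsum_subtype {i | U i ω = n} fun i => Measure.dirac (X i ω) B).trans ?_
  refine tsum_congr fun i => ?_
  rw [Measure.dirac_apply' _ hBn]
  by_cases h : U i ω = n
  · rw [Set.indicator_of_mem (by exact h), Measure.dirac_apply' _ hB]
    by_cases h' : X i ω ∈ B <;> simp [h, h']
  · rw [Set.indicator_of_notMem (by exact h), Set.indicator_of_notMem (by simp [h])]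

theorem sum_subProcess (ω : Ω) :
    Measure.sum (fun n => subProcess X U n ω) = pointProcess X ω := by
  ext B hB
  rw [Measure.sum_apply _ hB, pointProcess, Measure.sum_apply _ hB]
  simp_rw [subProcess, Measure.sum_apply _ hB]
  rw [← ENNReal.tsum_sigma' fun p : Σ n, {i // U i ω = n} => Measure.dirac (X p.2 ω) B]
  exact (Equiv.sigmaFiberEquiv fun i => U i ω).tsum_eq fun i => Measure.dirac (X i ω) B

theorem subProcess_le (n : ℕ) (ω : Ω) : subProcess X U n ω ≤ pointProcess X ω := by
  rw [← sum_subProcess (U := U)]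
  exact Measure.le_sum _ n

variable [MeasurableSpace Ω] {P : Measure Ω} {Λ : Measure Plane}

theorem measurable_subProcess (hX : ∀ i, Measurable (X i)) (hU : ∀ i, Measurable (U i)) (n : ℕ) :
    Measurable (subProcess X U n) := by
  refine Measure.measurable_of_measurable_coe _ fun B hB => ?_
  have hBn : MeasurableSet (B ×ˢ ({n} : Set ℕ)) := hB.prod (measurableSet_singleton n)
  simp_rw [subProcess_apply n _ hB, Measure.sum_apply _ hBn]
  exact Measurable.tsum fun i => (Measure.measurable_coe hBn).comp
    (Measure.measurable_dirac.comp ((hX i).prodMk (hU i)))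

theorem ae_subProcess_ne_top (hN : IsPoissonProcess P (pointProcess X) Λ) (n : ℕ)
    {B : Set Plane} (hB : MeasurableSet B) (hfin : Λ B ≠ ∞) :
    ∀ᵐ ω ∂P, subProcess X U n ω B ≠ ∞ := by
  filter_upwards [hN.ae_ne_top hB hfin] with ω hω
  exact ne_top_of_le_ne_top hω (subProcess_le n ω B)

variable [IsProbabilityMeasure P] [SigmaFinite Λ] {κ : Measure ℕ} [IsProbabilityMeasure κ]

/-- The joint characteristic function of counts of the sub-processes of a marked Poisson
process. -/
theorem integral_exp_sum_subProcess (hX : ∀ i, Measurable (X i)) (hU : ∀ i, Measurable (U i))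
    (hN : IsPoissonProcess P (pointProcess X) Λ) (hUlaw : ∀ i, HasLaw (U i) κ P)
    (hUind : iIndepFun U P) (hXU : IndepFun (fun ω i => X i ω) (fun ω i => U i ω) P)
    {S : Type*} [Fintype S] {ν : S → ℕ} (hν : Function.Injective ν) {L : S → Type*}
    [∀ s, Fintype (L s)] {B : (s : S) → L s → Set Plane} (hB : ∀ s l, MeasurableSet (B s l))
    (hfin : ∀ s l, Λ (B s l) ≠ ∞) (a : (s : S) → L s → ℝ) :
    ∫ ω, Complex.exp ((∑ s, ∑ l, a s l * (subProcess X U (ν s) ω (B s l)).toReal : ℝ) *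
        Complex.I) ∂P
      = ∏ s, Complex.exp (κ.real {ν s} *
        ∫ x, (Complex.exp ((∑ l, a s l * (B s l).indicator 1 x : ℝ) * Complex.I) - 1) ∂Λ) := by
  classical
  set f : (s : S) → Plane → ℝ := fun s x => ∑ l, a s l * (B s l).indicator 1 x with hf
  have hfm (s : S) : Measurable (f s) := Finset.measurable_fun_sum _ fun l _ =>
    (measurable_one.indicator (hB s l)).const_mul _
  have hfint (s : S) : Integrable (f s) Λ := integrable_finsetSum _ fun l _ =>
    ((integrable_indicator_iff (hB s l)).2 (integrableOn_const (hfin s l))).const_mul _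
  set h : Plane → ℕ → ℂ := fun x u =>
    Complex.exp ((∑ s, (if u = ν s then f s x else 0) : ℝ) * Complex.I) with hh
  have hm : Measurable (Function.uncurry h) := by
    refine Complex.measurable_exp.comp ((Complex.measurable_ofReal.comp ?_).mul_const _)
    refine Finset.measurable_fun_sum _ fun s _ => Measurable.ite ?_ ?_ measurable_const
    · exact measurable_snd (measurableSet_singleton (ν s))
    · exact (hfm s).comp measurable_fst
  have hb (x : Plane) (u : ℕ) : ‖h x u‖ ≤ 1 := (Complex.norm_exp_ofReal_mul_I _).le
  have hsplit (x : Plane) (u : ℕ) : h x u - 1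
      = ∑ s, ({ν s} : Set ℕ).indicator (fun _ => Complex.exp (f s x * Complex.I) - 1) u := by
    by_cases hu : ∃ s, u = ν s
    · obtain ⟨s, rfl⟩ := hu
      have e1 : (∑ s', (if ν s = ν s' then f s' x else 0) : ℝ) = f s x := by
        rw [Finset.sum_eq_single s (fun s' _ hs' => if_neg fun h => hs' (hν h).symm)
          (fun h => absurd (Finset.mem_univ s) h), if_pos rfl]
      rw [Finset.sum_eq_single s, Set.indicator_of_mem (Set.mem_singleton _)]
      · simp only [hh, e1]
      · intro s' _ hs'
        exact Set.indicator_of_notMem (fun h : ν s ∈ {ν s'} => hs' (hν h).symm) _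
      · exact fun h => absurd (Finset.mem_univ s) h
    · push Not at hu
      simp [hh, hu]
  have hEint (s : S) : Integrable (fun x => Complex.exp (f s x * Complex.I) - 1) Λ := by
    refine Integrable.mono' (hfint s).norm ?_ (ae_of_all _ fun x => ?_)
    · exact ((Complex.measurable_exp.comp ((Complex.measurable_ofReal.comp (hfm s)).mul_const
        _)).sub_const 1).aestronglyMeasurable
    · rw [mul_comm]
      exact Real.norm_exp_I_mul_ofReal_sub_one_le
  set H : Plane → ℂ := fun x => ∫ u, h x u ∂κ with hHdef
  have hH (i : ℕ) (x : Plane) : ∫ ω, h x (U i ω) ∂P = H x := by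
    simp only [hHdef]
    rw [← (hUlaw i).map_eq, integral_map (hU i).aemeasurable
      (Measurable.of_discrete.aestronglyMeasurable)]
  have hH1 (x : Plane) : H x - 1
      = ∑ s, (κ.real {ν s} : ℂ) * (Complex.exp (f s x * Complex.I) - 1) := by
    have hi : Integrable (h x) κ := Integrable.of_bound
      (Measurable.of_discrete.aestronglyMeasurable) 1 (ae_of_all _ (hb x))
    calc H x - 1 = ∫ u, (h x u - 1) ∂κ := by
          rw [integral_sub hi (integrable_const 1)]; simp [hHdef]
      _ = _ := by
          simp_rw [hsplit]
          rw [integral_finsetSum]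
          · refine Finset.sum_congr rfl fun s _ => ?_
            rw [integral_indicator_const _ (measurableSet_singleton _), Complex.real_smul]
          · intro s _
            exact (integrable_const _).indicator (measurableSet_singleton _)
  have hint : Integrable (fun x => H x - 1) Λ := by
    simp_rw [hH1]
    exact integrable_finsetSum _ fun s _ => (hEint s).const_mul _
  have key := hN.tendsto_integral_prod_marked hX hU hUind hXU hm hb hH hint
  have hlim : Tendsto (fun m => ∫ ω, ∏ i ∈ Finset.range m, h (X i ω) (U i ω) ∂P) atTop
      (𝓝 (∫ ω, Complex.exp ((∑ s, ∑ l, a s l * (subProcess X U (ν s) ω (B s l)).toReal : ℝ) *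
        Complex.I) ∂P)) := by
    refine tendsto_integral_of_dominated_convergence (fun _ => 1) (fun n => ?_)
      (integrable_const 1) (fun n => ae_of_all _ fun ω => norm_prod_le_one _ fun i => hb _ _) ?_
    · exact (Finset.measurable_fun_prod _ fun i _ =>
        hm.comp ((hX i).prodMk (hU i))).aestronglyMeasurable
    · have hae : ∀ᵐ ω ∂P, ∀ (s : S) (l : L s), subProcess X U (ν s) ω (B s l) ≠ ∞ :=
        ae_all_iff.2 fun s => ae_all_iff.2 fun l => ae_subProcess_ne_top hN _ (hB s l) (hfin s l)
      filter_upwards [hae] with ω hω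
      refine tendsto_const_nhds.congr' ?_
      have := eventually_all.2 fun s : S => eventually_all.2 fun l : L s =>
        eventually_card_filter_eq (x := fun i => (X i ω, U i ω))
          ((hB s l).prod (measurableSet_singleton (ν s)))
          (by rw [← subProcess_apply _ _ (hB s l)]; exact hω s l)
      filter_upwards [this] with m hm
      simp only [hh]
      rw [← Complex.exp_sum, ← Finset.sum_mul, ← Complex.ofReal_sum, Finset.sum_comm]
      congr 3
      refine Finset.sum_congr rfl fun s _ => ?_
      have e (i : ℕ) : (if U i ω = ν s then f s (X i ω) else 0)
          = ∑ l, a s l * (if (X i ω, U i ω) ∈ B s l ×ˢ ({ν s} : Set ℕ) then 1 else 0) := by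
        by_cases h' : U i ω = ν s
        · simp [h', hf, Set.indicator_apply]
        · simp [h']
      simp_rw [e]
      rw [Finset.sum_comm]
      refine Finset.sum_congr rfl fun l _ => ?_
      rw [← Finset.mul_sum, subProcess_apply _ _ (hB s l), ← hm s l, Finset.sum_boole]
      simp
  rw [tendsto_nhds_unique hlim key, ← Complex.exp_sum]
  simp_rw [hH1]
  rw [integral_finsetSum _ fun s _ => (hEint s).const_mul _]
  simp_rw [integral_const_mul, hf]

theorem integral_exp_subProcess (hX : ∀ i, Measurable (X i)) (hU : ∀ i, Measurable (U i))
    (hN : IsPoissonProcess P (pointProcess X) Λ) (hUlaw : ∀ i, HasLaw (U i) κ P)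
    (hUind : iIndepFun U P) (hXU : IndepFun (fun ω i => X i ω) (fun ω i => U i ω) P)
    (n : ℕ) {L : Type*} [Fintype L] {B : L → Set Plane} (hB : ∀ l, MeasurableSet (B l))
    (hfin : ∀ l, Λ (B l) ≠ ∞) (a : L → ℝ) :
    ∫ ω, Complex.exp ((∑ l, a l * (subProcess X U n ω (B l)).toReal : ℝ) * Complex.I) ∂P
      = Complex.exp (κ.real {n} *
        ∫ x, (Complex.exp ((∑ l, a l * (B l).indicator 1 x : ℝ) * Complex.I) - 1) ∂Λ) := by
  simpa using integral_exp_sum_subProcess hX hU hN hUlaw hUind hXU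
    (S := Unit) (ν := fun _ => n) (fun _ _ _ => rfl) (L := fun _ => L) (B := fun _ => B)
    (fun _ => hB) (fun _ => hfin) (fun _ => a)

theorem integral_exp_subProcess_of_disjoint (hX : ∀ i, Measurable (X i))
    (hU : ∀ i, Measurable (U i))
    (hN : IsPoissonProcess P (pointProcess X) Λ) (hUlaw : ∀ i, HasLaw (U i) κ P)
    (hUind : iIndepFun U P) (hXU : IndepFun (fun ω i => X i ω) (fun ω i => U i ω) P)
    (n : ℕ) {L : Type*} [Fintype L] {B : L → Set Plane} (hB : ∀ l, MeasurableSet (B l))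
    (hfin : ∀ l, Λ (B l) ≠ ∞) (hd : Pairwise fun l l' => Disjoint (B l) (B l')) (a : L → ℝ) :
    ∫ ω, Complex.exp ((∑ l, a l * (subProcess X U n ω (B l)).toReal : ℝ) * Complex.I) ∂P
      = ∏ l, Complex.exp (κ.real {n} * Λ.real (B l) * (Complex.exp (a l * Complex.I) - 1)) := by
  classical
  rw [integral_exp_subProcess hX hU hN hUlaw hUind hXU n hB hfin, ← Complex.exp_sum]
  have hsplit (x : Plane) : Complex.exp ((∑ l, a l * (B l).indicator 1 x : ℝ) * Complex.I) - 1
      = ∑ l, (B l).indicator (fun _ => Complex.exp (a l * Complex.I) - 1) x := by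
    by_cases hx : ∃ l, x ∈ B l
    · obtain ⟨l, hl⟩ := hx
      have hne (l' : L) (h : l' ≠ l) : x ∉ B l' := Set.disjoint_right.1 (hd h) hl
      rw [Finset.sum_eq_single l (fun l' _ h => by
        rw [Set.indicator_of_notMem (hne l' h), mul_zero]) (fun h => absurd (Finset.mem_univ l) h),
        Finset.sum_eq_single l (fun l' _ h => Set.indicator_of_notMem (hne l' h) _)
          (fun h => absurd (Finset.mem_univ l) h)]
      simp [hl]
    · push Not at hx
      simp [hx]
  simp_rw [hsplit]
  rw [integral_finsetSum]
  · rw [Finset.mul_sum]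
    congr 1
    refine Finset.sum_congr rfl fun l _ => ?_
    rw [integral_indicator_const _ (hB l), Complex.real_smul, mul_assoc]
  · intro l _
    exact (integrable_indicator_iff (hB l)).2 (integrableOn_const (hfin l))

/-- Thinning of a Poisson process: the points with a given mark form a Poisson process. -/
theorem isPoissonProcess_subProcess (hX : ∀ i, Measurable (X i)) (hU : ∀ i, Measurable (U i))
    (hN : IsPoissonProcess P (pointProcess X) Λ) (hUlaw : ∀ i, HasLaw (U i) κ P)
    (hUind : iIndepFun U P) (hXU : IndepFun (fun ω i => X i ω) (fun ω i => U i ω) P)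
    (n : ℕ) (hn : κ {n} ≠ 0) : IsPoissonProcess P (subProcess X U n) (κ {n} • Λ) := by
  have hfin' {B : Set Plane} (h : (κ {n} • Λ) B ≠ ∞) : Λ B ≠ ∞ := by
    rw [Measure.smul_apply, smul_eq_mul] at h
    exact fun h' => h (by rw [h', ENNReal.mul_top hn])
  have hmeas {B : Set Plane} (hB : MeasurableSet B) : Measurable fun ω => subProcess X U n ω B :=
    (Measure.measurable_coe hB).comp (measurable_subProcess hX hU n)
  have hreal (B : Set Plane) : (κ {n} • Λ).real B = κ.real {n} * Λ.real B := by
    simp [measureReal_def]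
  have hchar {B : Set Plane} (hB : MeasurableSet B) (h : (κ {n} • Λ) B ≠ ∞) (t : ℝ) :
      charFun (P.map fun ω => (subProcess X U n ω B).toReal) t
        = Complex.exp (κ.real {n} * Λ.real B * (Complex.exp (t * Complex.I) - 1)) := by
    rw [charFun_apply, integral_map (hmeas hB).ennreal_toReal.aemeasurable (by fun_prop)]
    have := integral_exp_subProcess_of_disjoint hX hU hN hUlaw hUind hXU n (L := Unit)
      (B := fun _ => B) (fun _ => hB) (fun _ => hfin' h) (fun l l' h => absurd rfl h) (fun _ => t)
    simpa [mul_comm] using this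
  constructor
  · intro B hB h
    refine ⟨(hmeas hB).aemeasurable, ?_⟩
    have hlaw : P.map (fun ω => (subProcess X U n ω B).toReal)
        = (poissonMeasure ((κ {n} • Λ) B).toNNReal).map (Nat.cast : ℕ → ℝ) := by
      have : IsProbabilityMeasure (P.map fun ω => (subProcess X U n ω B).toReal) :=
        Measure.isProbabilityMeasure_map (hmeas hB).ennreal_toReal.aemeasurable
      refine Measure.ext_of_charFun (funext fun t => ?_)
      rw [hchar hB h, charFun_map_cast_poissonMeasure]
      congr 2
      rw [← Complex.ofReal_mul, ← hreal]
      rfl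
    have hae : (fun ω => subProcess X U n ω B)
        =ᵐ[P] fun ω => ENNReal.ofReal (subProcess X U n ω B).toReal := by
      filter_upwards [ae_subProcess_ne_top (U := U) hN n hB (hfin' h)] with ω hω
      rw [ENNReal.ofReal_toReal hω]
    rw [Measure.map_congr hae, ← Function.comp_def ENNReal.ofReal,
      ← Measure.map_map ENNReal.measurable_ofReal (hmeas hB).ennreal_toReal, hlaw,
      Measure.map_map ENNReal.measurable_ofReal .of_discrete]
    congr 1
    ext k
    simp
  · intro m B hB h hd
    have hind : iIndepFun (fun l ω => (subProcess X U n ω (B l)).toReal) P := by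
      rw [iIndepFun_iff_charFun_pi fun l => (hmeas (hB l)).ennreal_toReal.aemeasurable]
      intro t
      have hmv : Measurable fun ω => WithLp.toLp 2 fun l => (subProcess X U n ω (B l)).toReal :=
        (WithLp.measurable_toLp 2 _).comp
          (measurable_pi_lambda _ fun l => (hmeas (hB l)).ennreal_toReal)
      rw [charFun_apply, integral_map hmv.aemeasurable (by fun_prop)]
      simp_rw [hchar (hB _) (h _)]
      rw [← integral_exp_subProcess_of_disjoint hX hU hN hUlaw hUind hXU n hB
        (fun l => hfin' (h l)) hd]
      simp [PiLp.inner_apply]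
    refine (iIndepFun_congr fun l => ?_).1
      (hind.comp (fun _ => ENNReal.ofReal) fun _ => ENNReal.measurable_ofReal)
    filter_upwards [ae_subProcess_ne_top (U := U) hN n (hB l) (hfin' (h l))] with ω hω
    exact ENNReal.ofReal_toReal hω

/-- Thinning of a Poisson process: the points with different marks form independent processes. -/
theorem iIndepFun_subProcess (hX : ∀ i, Measurable (X i)) (hU : ∀ i, Measurable (U i))
    (hN : IsPoissonProcess P (pointProcess X) Λ) (hUlaw : ∀ i, HasLaw (U i) κ P)
    (hUind : iIndepFun U P) (hXU : IndepFun (fun ω i => X i ω) (fun ω i => U i ω) P) :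
    iIndepFun (fun n ω => subProcess X U n ω) P := by
  have hmeas (n : ℕ) {B : Set Plane} (hB : MeasurableSet B) :
      Measurable fun ω => subProcess X U n ω B :=
    (Measure.measurable_coe hB).comp (measurable_subProcess hX hU n)
  let T : Type := {B : Set Plane // MeasurableSet B ∧ Λ B ≠ ∞}
  have hproc : iIndepFun (fun (n : ℕ) ω (B : T) => subProcess X U n ω B.1) P := by
    refine iIndepFun.iIndepFun_process (T := fun _ => T) (fun n B => hmeas n B.2.1) fun I J => ?_
    have hmv (n : I) : Measurable fun ω =>
        WithLp.toLp 2 fun B : J n => (subProcess X U n ω B.1.1).toReal :=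
      (WithLp.measurable_toLp 2 _).comp
        (measurable_pi_lambda _ fun B => (hmeas n B.1.2.1).ennreal_toReal)
    have hind : iIndepFun (fun (n : I) ω =>
        (WithLp.toLp 2 fun B : J n => (subProcess X U n ω B.1.1).toReal :
          EuclideanSpace ℝ (J n))) P := by
      rw [iIndepFun_iff_charFun_pi fun n => (hmv n).aemeasurable]
      intro t
      have hmv' : Measurable fun ω => WithLp.toLp 2 fun n : I =>
          (WithLp.toLp 2 fun B : J n => (subProcess X U n ω B.1.1).toReal :
            EuclideanSpace ℝ (J n)) :=
        (WithLp.measurable_toLp 2 _).comp (measurable_pi_lambda _ hmv)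
      have h1 := integral_exp_sum_subProcess hX hU hN hUlaw hUind hXU (S := I)
        (ν := fun n => n) Subtype.val_injective (L := fun n => J n) (B := fun n B => B.1.1)
        (fun n B => B.1.2.1) (fun n B => B.1.2.2) (fun n B => t n B)
      have h2 (n : I) := integral_exp_subProcess hX hU hN hUlaw hUind hXU n (L := J n)
        (B := fun B => B.1.1) (fun B => B.1.2.1) (fun B => B.1.2.2) (fun B => t n B)
      have h3 (n : I) : charFun (P.map fun ω =>
          (WithLp.toLp 2 fun B : J n => (subProcess X U n ω B.1.1).toReal :
            EuclideanSpace ℝ (J n))) (t n) = ∫ ω, Complex.exp ((∑ B : J n,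
              t n B * (subProcess X U n ω B.1.1).toReal : ℝ) * Complex.I) ∂P := by
        rw [charFun_apply, integral_map (hmv n).aemeasurable (by fun_prop)]
        simp [PiLp.inner_apply]
      simp_rw [h3, h2]
      rw [← h1, charFun_apply, integral_map hmv'.aemeasurable (by fun_prop)]
      simp [PiLp.inner_apply]
    have hcomp := hind.comp (fun n (v : EuclideanSpace ℝ (J n)) B => ENNReal.ofReal (v B))
      (fun n => measurable_pi_lambda _ fun B => ENNReal.measurable_ofReal.comp (by fun_prop))
    refine (iIndepFun_congr fun n => ?_).1 hcomp
    have hae : ∀ᵐ ω ∂P, ∀ B : J n, subProcess X U n ω B.1.1 ≠ ∞ :=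
      ae_all_iff.2 fun B => ae_subProcess_ne_top hN n B.1.2.1 B.1.2.2
    filter_upwards [hae] with ω hω
    funext B
    exact ENNReal.ofReal_toReal (hω B)
  rw [iIndepFun_iff_iIndep] at hproc ⊢
  refine iIndep_of_iIndep_of_le hproc fun n => ?_
  let m' : MeasurableSpace Ω :=
    MeasurableSpace.comap (fun ω (B : T) => subProcess X U n ω B.1) inferInstance
  have hT (B : T) : Measurable[m'] fun ω => subProcess X U n ω B.1 :=
    (measurable_pi_apply B).comp (comap_measurable fun ω (B : T) => subProcess X U n ω B.1)
  have hm' : Measurable[m'] (subProcess X U n) := by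
    refine @Measure.measurable_of_measurable_coe _ _ _ m' _ fun B hB => ?_
    have hsup : (fun ω => subProcess X U n ω B)
        = fun ω => ⨆ k, subProcess X U n ω (B ∩ spanningSets Λ k) := by
      funext ω
      rw [← Monotone.measure_iUnion fun k k' h =>
        Set.inter_subset_inter_right B (monotone_spanningSets Λ h), ← Set.inter_iUnion,
        iUnion_spanningSets, Set.inter_univ]
    rw [hsup]
    exact @Measurable.iSup _ _ _ _ _ m' _ _ _ _ _ _ fun k => hT ⟨B ∩ spanningSets Λ k,
      hB.inter (measurableSet_spanningSets Λ k), ((measure_mono Set.inter_subset_right).trans_lt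
        (measure_spanningSets_lt_top Λ k)).ne⟩
  exact hm'.comap_le

end

section

theorem gammaMeasure_eq_withDensity (a r : ℝ) : gammaMeasure a r =
    (volume.restrict (Set.Ioi 0)).withDensity fun x =>
      ENNReal.ofReal (r ^ a / Real.Gamma a * x ^ (a - 1) * Real.exp (-(r * x))) := by
  rw [gammaMeasure, Measure.restrict_congr_set Ioi_ae_eq_Ici,
    ← withDensity_indicator measurableSet_Ici]
  congr 1
  ext x
  rw [gammaPDF_eq, Set.indicator_apply]
  by_cases h : 0 ≤ x <;> simp [h]

theorem mem_integrableExpSet_gammaMeasure {a r z : ℝ} (ha : 0 < a) (hr : 0 < r) (hz : z < r) :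
    z ∈ integrableExpSet id (gammaMeasure a r) := by
  rw [integrableExpSet, Set.mem_ofPred_eq, gammaMeasure_eq_withDensity,
    integrable_withDensity_iff (by fun_prop) (ae_of_all _ fun _ => ENNReal.ofReal_lt_top)]
  have h := (integrableOn_rpow_mul_exp_neg_mul_rpow (s := a - 1) (p := 1) (b := r - z)
    (by linarith) one_pos (by linarith)).const_mul (r ^ a / Real.Gamma a)
  refine IntegrableOn.congr_fun h (fun x hx => ?_) measurableSet_Ioi
  have hx : 0 < x := hx
  have hG := Real.Gamma_pos_of_pos ha
  rw [ENNReal.toReal_ofReal (by positivity), Real.rpow_one]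
  simp only [id]
  rw [show -(r - z) * x = z * x + -(r * x) by ring, Real.exp_add]
  ring

theorem mgf_gammaMeasure {a r z : ℝ} (ha : 0 < a) (hr : 0 < r) (hz : z < r) :
    mgf id (gammaMeasure a r) z = (1 - z / r) ^ (-a) := by
  rw [mgf, gammaMeasure_eq_withDensity, integral_withDensity_eq_integral_toReal_smul
    (by fun_prop) (ae_of_all _ fun _ => ENNReal.ofReal_lt_top)]
  have hG := Real.Gamma_pos_of_pos ha
  have h1 : 0 < r - z := by linarith
  calc _ = ∫ x in Set.Ioi 0, r ^ a / Real.Gamma a * (x ^ (a - 1) * Real.exp (-((r - z) * x))) := by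
        refine setIntegral_congr_fun measurableSet_Ioi fun x hx => ?_
        have hx : 0 < x := hx
        simp only [id, smul_eq_mul]
        rw [ENNReal.toReal_ofReal (by positivity),
          show -((r - z) * x) = z * x + -(r * x) by ring, Real.exp_add]
        ring
    _ = _ := by
        rw [integral_const_mul, Real.integral_rpow_mul_exp_neg_mul_Ioi ha h1,
          show 1 - z / r = (r - z) / r by field_simp, Real.rpow_neg (by positivity),
          Real.div_rpow h1.le hr.le, Real.div_rpow zero_le_one h1.le, Real.one_rpow]
        have := Real.rpow_pos_of_pos h1 a
        field_simp

theorem charFun_gammaMeasure {a r : ℝ} (ha : 0 < a) (hr : 0 < r) (t : ℝ) :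
    charFun (gammaMeasure a r) t = (1 - Complex.I * ((t * r⁻¹ : ℝ) : ℂ)) ^ (-(a : ℂ)) := by
  have : IsProbabilityMeasure (gammaMeasure a r) := isProbabilityMeasure_gammaMeasure ha hr
  set D : Set ℂ := {z | z.re < r} with hD
  have hDo : IsOpen D := isOpen_lt Complex.continuous_re continuous_const
  have hDc : IsPreconnected D := (convex_halfSpace_re_lt r).isPreconnected
  have h0 : (0 : ℂ) ∈ D := by simpa [hD] using hr
  have hf : AnalyticOnNhd ℂ (complexMGF id (gammaMeasure a r)) D := by
    refine analyticOnNhd_complexMGF.mono fun z hz => ?_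
    exact interior_maximal (fun x (hx : x < r) => mem_integrableExpSet_gammaMeasure ha hr hx)
      isOpen_Iio hz
  have hg : AnalyticOnNhd ℂ (fun z : ℂ => (1 - z / r) ^ (-(a : ℂ))) D := by
    refine DifferentiableOn.analyticOnNhd (fun z hz => ?_) hDo
    refine DifferentiableAt.differentiableWithinAt ?_
    refine DifferentiableAt.cpow_const (by fun_prop) (Or.inl ?_)
    have : z.re / r < 1 := (div_lt_one hr).2 hz
    simpa [Complex.div_ofReal_re] using this
  have hreal : ∀ᶠ x : ℝ in 𝓝[≠] 0, complexMGF id (gammaMeasure a r) (x : ℂ)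
      = (1 - (x : ℂ) / r) ^ (-(a : ℂ)) := by
    filter_upwards [nhdsWithin_le_nhds (gt_mem_nhds hr)] with x hx
    have : 0 ≤ 1 - x / r := by
      have : x / r < 1 := (div_lt_one hr).2 hx
      linarith
    rw [complexMGF_ofReal, mgf_gammaMeasure ha hr hx, Complex.ofReal_cpow this]
    push_cast
    rfl
  have htend : Tendsto (fun x : ℝ => (x : ℂ)) (𝓝[≠] 0) (𝓝[≠] 0) := by
    refine tendsto_nhdsWithin_of_tendsto_nhds_of_eventually_within _ ?_ ?_
    · exact (Complex.continuous_ofReal.tendsto' 0 0 (by simp)).mono_left nhdsWithin_le_nhds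
    · filter_upwards [self_mem_nhdsWithin] with x hx
      simpa using hx
  have heq := hf.eqOn_of_preconnected_of_frequently_eq hg hDc h0
    (htend.frequently hreal.frequently)
  have hmem : (t : ℂ) * Complex.I ∈ D := by simpa [hD] using hr
  rw [← complexMGF_id_mul_I, heq hmem]
  push_cast
  field_simp

theorem lintegral_enorm_gammaMeasure {a r : ℝ} (ha : 0 < a) (hr : 0 < r) :
    ∫⁻ x, ‖x‖ₑ ∂(gammaMeasure a r) = ENNReal.ofReal (a / r) := by
  have hG := Real.Gamma_pos_of_pos ha
  have hi : IntegrableOn (fun x : ℝ => r ^ a / Real.Gamma a *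
      (x ^ ((a + 1) - 1) * Real.exp (-(r * x)))) (Set.Ioi 0) := by
    have h := (integrableOn_rpow_mul_exp_neg_mul_rpow (s := a) (p := 1) (b := r)
      (by linarith) one_pos hr).const_mul (r ^ a / Real.Gamma a)
    simpa [IntegrableOn] using h
  rw [gammaMeasure_eq_withDensity, lintegral_withDensity_eq_lintegral_mul _ (by fun_prop)
    (by fun_prop)]
  calc _ = ∫⁻ x in Set.Ioi 0, ENNReal.ofReal (r ^ a / Real.Gamma a *
        (x ^ ((a + 1) - 1) * Real.exp (-(r * x)))) := by
        refine setLIntegral_congr_fun measurableSet_Ioi fun x hx => ?_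
        have hx : 0 < x := hx
        simp only [Pi.mul_apply]
        rw [← ofReal_norm, ← ENNReal.ofReal_mul (by positivity), Real.norm_of_nonneg hx.le,
          add_sub_cancel_right]
        congr 1
        rw [Real.rpow_sub_one hx.ne']
        field_simp
    _ = _ := by
        rw [← ofReal_integral_eq_lintegral_ofReal hi, integral_const_mul,
          Real.integral_rpow_mul_exp_neg_mul_Ioi (by linarith) hr, Real.Gamma_add_one ha.ne',
          Real.div_rpow zero_le_one hr.le, Real.one_rpow, Real.rpow_add_one hr.ne']
        · congr 1
          have := Real.rpow_pos_of_pos hr a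
          field_simp
        · refine (ae_restrict_iff' measurableSet_Ioi).2 (ae_of_all _ fun x hx => ?_)
          have hx : 0 < x := hx
          positivity

theorem gammaShape_pos {M m : ℕ} (hM : 1 ≤ M) (hm : 1 ≤ m) : 0 < gammaShape M m := by
  have hM' : (1 : ℝ) ≤ M := by exact_mod_cast hM
  unfold gammaShape
  split_ifs with h
  · have : 0 < (M : ℝ) ^ 2 + 2 * M - 1 := by nlinarith
    positivity
  · have h2 : (2 : ℝ) ≤ m := by exact_mod_cast (by omega : 2 ≤ m)
    have h3 : 0 < (M : ℝ) * m - 1 := by nlinarith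
    have h4 : 0 < (m : ℝ) - 1 := by linarith
    positivity

theorem gammaScale_pos {M m : ℕ} (hM : 1 ≤ M) (hm : 1 ≤ m) : 0 < gammaScale M m := by
  have hM' : (1 : ℝ) ≤ M := by exact_mod_cast hM
  unfold gammaScale
  split_ifs with h
  · have : 0 < (M : ℝ) ^ 2 + 2 * M - 1 := by nlinarith
    positivity
  · have h2 : (2 : ℝ) ≤ m := by exact_mod_cast (by omega : 2 ≤ m)
    have h3 : 0 < (M : ℝ) * m - 1 := by nlinarith
    have h4 : 0 < (m : ℝ) - 1 := by linarith
    positivity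

theorem gammaShape_mul_gammaScale_le_one {M m : ℕ} (hM : 1 ≤ M) (hm : 1 ≤ m) :
    gammaShape M m * gammaScale M m ≤ 1 := by
  have hM' : (1 : ℝ) ≤ M := by exact_mod_cast hM
  unfold gammaScale gammaShape
  split_ifs with h
  · have : 0 < (M : ℝ) ^ 2 + 2 * M - 1 := by nlinarith
    exact (div_mul_div_cancel₀ (by positivity)).trans_le (div_self (by positivity)).le
  · have h2 : (2 : ℝ) ≤ m := by exact_mod_cast (by omega : 2 ≤ m)
    have h3 : 0 < (M : ℝ) * m - 1 := by nlinarith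
    have h4 : 0 < (m : ℝ) - 1 := by linarith
    have : ((M : ℝ) * m - 1) / (3 * M * m * (m - 1)) * (3 * (m - 1) / (m * (M * m - 1)))
        = 1 / (M * (m * m)) := by field_simp
    rw [this, div_le_one (by positivity)]
    nlinarith [mul_le_mul h2 h2 (by norm_num) (by linarith)]

theorem truncPoissonMeasure_zero (μ : ℝ) : truncPoissonMeasure μ {0} = 0 := by
  rw [truncPoissonMeasure, cond_apply (by measurability)]
  simp

theorem truncPoissonMeasure_real_singleton {μ : ℝ} (hμ : 0 < μ) {m : ℕ} (hm : 1 ≤ m) :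
    (truncPoissonMeasure μ).real {m} = truncPoissonProb μ m := by
  have h1 : ({0}ᶜ ∩ {m} : Set ℕ) = {m} := by
    ext k
    simp only [Set.mem_inter_iff, Set.mem_compl_iff, Set.mem_singleton_iff]
    omega
  rw [truncPoissonMeasure, measureReal_def, cond_apply (by measurability), h1, ENNReal.toReal_mul,
    ENNReal.toReal_inv, ← measureReal_def, ← measureReal_def, probReal_compl_eq_one_sub (measurableSet_singleton 0), poissonMeasure_real_singleton,
    poissonMeasure_real_singleton, truncPoissonProb, Real.coe_toNNReal _ hμ.le]
  simp
  ring

theorem isProbabilityMeasure_truncPoissonMeasure {μ : ℝ} (hμ : 0 < μ) :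
    IsProbabilityMeasure (truncPoissonMeasure μ) := by
  refine cond_isProbabilityMeasure fun h => ?_
  have h1 : poissonMeasure μ.toNNReal {1} = 0 := measure_mono_null (by simp) h
  have h2 := poissonMeasure_real_singleton_pos (r := μ.toNNReal) 1 (by simpa using hμ)
  simp [measureReal_def, h1] at h2

theorem hasSum_integral_truncPoissonMeasure {μ : ℝ} (hμ : 0 < μ) {f : ℕ → ℂ} {c : ℝ}
    (hf : ∀ m, 1 ≤ m → ‖f m‖ ≤ c) :
    HasSum (fun m : ℕ+ => (truncPoissonProb μ m : ℂ) * f m) (∫ m, f m ∂(truncPoissonMeasure μ)) := by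
  have := isProbabilityMeasure_truncPoissonMeasure hμ
  have hae : ∀ᵐ m ∂(truncPoissonMeasure μ), ‖f m‖ ≤ c := by
    have : ∀ᵐ m ∂(truncPoissonMeasure μ), m ≠ 0 := by
      simpa [ae_iff] using truncPoissonMeasure_zero μ
    filter_upwards [this] with m hm using hf m (Nat.one_le_iff_ne_zero.2 hm)
  have hint : Integrable f (truncPoissonMeasure μ) :=
    Integrable.of_bound Measurable.of_discrete.aestronglyMeasurable c hae
  have h := hasSum_integral_iUnion (f := f) (μ := truncPoissonMeasure μ)
    (s := fun m : ℕ => {m}) (fun m => measurableSet_singleton m)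
    (fun m m' h => by simpa using h) hint.integrableOn
  rw [Set.iUnion_of_singleton, setIntegral_univ] at h
  rw [← PNat.coe_injective.hasSum_iff] at h
  · refine h.congr_fun fun m => ?_
    rw [← truncPoissonMeasure_real_singleton hμ m.pos]
    simp [measureReal_def]
  · intro m hm
    have : m = 0 := by
      by_contra h0
      exact hm ⟨⟨m, Nat.pos_of_ne_zero h0⟩, rfl⟩
    rw [this, Measure.restrict_eq_zero.2 (truncPoissonMeasure_zero μ), integral_zero_measure]

end

section

section Radial

theorem measurableSet_outerRegion (r₁ : ℝ) : MeasurableSet (outerRegion r₁) :=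
  measurableSet_lt measurable_const measurable_norm

instance sigmaFinite_homogeneous (lam : ℝ) (A : Set Plane) : SigmaFinite (homogeneous lam A) := by
  unfold homogeneous
  rw [ENNReal.ofReal]
  exact inferInstanceAs (SigmaFinite (lam.toNNReal • volume.restrict A))

theorem indicator_outerRegion {F : Type*} [Zero F] (r₁ : ℝ) (f : ℝ → F) :
    (outerRegion r₁).indicator (fun x => f ‖x‖) = fun x => (Set.Ioi r₁).indicator f ‖x‖ := by
  ext x
  simp [Set.indicator_apply, outerRegion]

theorem integral_homogeneous_outerRegion {lam r₁ : ℝ} (hlam : 0 ≤ lam) (hr₁ : 0 < r₁)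
    (f : ℝ → ℂ) : ∫ x, f ‖x‖ ∂(homogeneous lam (outerRegion r₁))
      = 2 * Real.pi * lam * ∫ r in Set.Ioi r₁, f r * r := by
  have hball : (volume : Measure Plane).real (Metric.ball 0 1) = Real.pi := by
    rw [measureReal_def, EuclideanSpace.volume_ball_fin_two]
    simp [Real.pi_pos.le]
  rw [homogeneous, integral_smul_measure, ENNReal.toReal_ofReal hlam,
    ← integral_indicator (measurableSet_outerRegion r₁), indicator_outerRegion,
    integral_fun_norm_addHaar, hball]
  have hind : (fun y : ℝ => y ^ (Module.finrank ℝ Plane - 1) • (Set.Ioi r₁).indicator f y)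
      = (Set.Ioi r₁).indicator fun y => f y * y := by
    ext y
    by_cases hy : y ∈ Set.Ioi r₁ <;> simp [hy, mul_comm]
  rw [hind, setIntegral_indicator measurableSet_Ioi, Set.inter_eq_right.2
    (Set.Ioi_subset_Ioi hr₁.le)]
  simp only [finrank_euclideanSpace, Fintype.card_fin, Complex.real_smul, nsmul_eq_mul]
  push_cast
  ring

theorem integrableOn_rpow_neg_mul_self {r₁ α : ℝ} (hr₁ : 0 < r₁) (hα : 2 < α) :
    IntegrableOn (fun r : ℝ => r ^ (-α) * r) (Set.Ioi r₁) := by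
  refine (integrableOn_Ioi_rpow_of_lt (a := -α + 1) (by linarith) hr₁).congr_fun (fun r hr => ?_)
    measurableSet_Ioi
  exact Real.rpow_add_one (hr₁.trans hr).ne' _

theorem integrable_norm_rpow_neg {lam r₁ α : ℝ} (hr₁ : 0 < r₁) (hα : 2 < α) :
    Integrable (fun x : Plane => ‖x‖ ^ (-α)) (homogeneous lam (outerRegion r₁)) := by
  refine Integrable.smul_measure ?_ ENNReal.ofReal_ne_top
  rw [← IntegrableOn, ← integrable_indicator_iff (measurableSet_outerRegion r₁),
    indicator_outerRegion r₁ fun r => r ^ (-α), integrable_fun_norm_addHaar]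
  have hind : (fun y : ℝ => y ^ (Module.finrank ℝ Plane - 1) •
      (Set.Ioi r₁).indicator (fun r => r ^ (-α)) y)
      = (Set.Ioi r₁).indicator fun y => y ^ (-α) * y := by
    ext y
    by_cases hy : y ∈ Set.Ioi r₁ <;> simp [hy, mul_comm]
  rw [hind]
  exact ((integrableOn_rpow_neg_mul_self hr₁ hα).integrable_indicator
    measurableSet_Ioi).integrableOn

end Radial

section Mixture

variable {Ω : Type*} [MeasurableSpace Ω] {P : Measure Ω} [IsProbabilityMeasure P]

theorem integral_comp_pair {α β : Type*} [MeasurableSpace α] [MeasurableSpace β] {A : Ω → α}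
    {B : Ω → β} (mA : Measurable A) (mB : Measurable B) (hAB : IndepFun A B P) {f : α → β → ℂ}
    (mf : Measurable (Function.uncurry f)) {c : ℝ} (hf : ∀ a b, ‖f a b‖ ≤ c) :
    ∫ ω, f (A ω) (B ω) ∂P = ∫ a, ∫ ω, f a (B ω) ∂P ∂(P.map A) := by
  have hA : IsProbabilityMeasure (P.map A) := Measure.isProbabilityMeasure_map mA.aemeasurable
  have hB : IsProbabilityMeasure (P.map B) := Measure.isProbabilityMeasure_map mB.aemeasurable
  have hlaw := (indepFun_iff_map_prod_eq_prod_map_map mA.aemeasurable mB.aemeasurable).1 hAB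
  calc ∫ ω, f (A ω) (B ω) ∂P = ∫ q, Function.uncurry f q ∂(P.map fun ω => (A ω, B ω)) :=
        (integral_map (mA.prodMk mB).aemeasurable mf.aestronglyMeasurable).symm
    _ = ∫ a, ∫ b, f a b ∂(P.map B) ∂(P.map A) := by
        rw [hlaw, integral_prod]
        · rfl
        · exact Integrable.of_bound mf.aestronglyMeasurable c (ae_of_all _ fun q => hf _ _)
    _ = _ := by
        refine integral_congr_ae (ae_of_all _ fun a => ?_)
        exact integral_map mB.aemeasurable (mf.comp measurable_prodMk_left).aestronglyMeasurable

theorem lintegral_comp_pair {α β : Type*} [MeasurableSpace α] [MeasurableSpace β] {A : Ω → α}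
    {B : Ω → β} (mA : Measurable A) (mB : Measurable B) (hAB : IndepFun A B P)
    {f : α → β → ℝ≥0∞} (mf : Measurable (Function.uncurry f)) :
    ∫⁻ ω, f (A ω) (B ω) ∂P = ∫⁻ a, ∫⁻ ω, f a (B ω) ∂P ∂(P.map A) := by
  have hB : IsProbabilityMeasure (P.map B) := Measure.isProbabilityMeasure_map mB.aemeasurable
  have hlaw := (indepFun_iff_map_prod_eq_prod_map_map mA.aemeasurable mB.aemeasurable).1 hAB
  calc ∫⁻ ω, f (A ω) (B ω) ∂P = ∫⁻ q, Function.uncurry f q ∂(P.map fun ω => (A ω, B ω)) :=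
        (lintegral_map mf (mA.prodMk mB)).symm
    _ = ∫⁻ a, ∫⁻ b, f a b ∂(P.map B) ∂(P.map A) := by
        rw [hlaw, lintegral_prod _ mf.aemeasurable]
        rfl
    _ = _ := lintegral_congr fun a => lintegral_map (mf.comp measurable_prodMk_left) mB

theorem measurable_eval_nat_prod : Measurable fun q : ℕ × (ℕ → ℝ) => q.2 q.1 :=
  measurable_from_prod_countable_right fun m => measurable_pi_apply m

variable {M : ℕ} {μ : ℝ} {C : Ω → ℕ} {Z : ℕ → Ω → ℝ}

theorem hasSum_charFun_powerCoefficient (hM : 1 ≤ M) (hμ : 0 < μ) (mC : Measurable C)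
    (mZ : ∀ m, Measurable (Z m)) (hC : HasLaw C (truncPoissonMeasure μ) P)
    (hZ : ∀ m, 1 ≤ m → HasLaw (Z m) (gammaMeasure (gammaShape M m) (gammaScale M m)⁻¹) P)
    (hCZ : IndepFun C (fun ω m => Z m ω) P) (s : ℝ) :
    HasSum (fun m : ℕ+ => (truncPoissonProb μ m : ℂ) *
        (1 - Complex.I * ((s * gammaScale M m : ℝ) : ℂ)) ^ (-(gammaShape M m : ℂ)))
      (charFun (P.map fun ω => Z (C ω) ω) s) := by
  have mZ' : Measurable fun ω m => Z m ω := measurable_pi_lambda _ mZ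
  have mW : Measurable fun ω => Z (C ω) ω := measurable_eval_nat_prod.comp (mC.prodMk mZ')
  have h1 : charFun (P.map fun ω => Z (C ω) ω) s
      = ∫ m, charFun (P.map (Z m)) s ∂(truncPoissonMeasure μ) := by
    rw [charFun_apply_real, integral_map mW.aemeasurable (by fun_prop)]
    have := integral_comp_pair mC mZ' hCZ (c := 1)
      (f := fun m z => Complex.exp (s * (z m : ℝ) * Complex.I))
      (Complex.measurable_exp.comp (((Complex.measurable_ofReal.comp
        measurable_eval_nat_prod).const_mul _).mul_const _))
      (fun m z => by
        rw [← Complex.ofReal_mul]; exact (Complex.norm_exp_ofReal_mul_I _).le)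
    rw [this, hC.map_eq]
    refine integral_congr_ae (ae_of_all _ fun m => ?_)
    simp only
    rw [charFun_apply_real, integral_map (mZ m).aemeasurable (by fun_prop)]
  rw [h1]
  refine (hasSum_integral_truncPoissonMeasure hμ (c := 1) fun m hm => ?_).congr_fun fun m => ?_
  · have : IsProbabilityMeasure (P.map (Z m)) :=
      Measure.isProbabilityMeasure_map (mZ m).aemeasurable
    exact norm_charFun_le_one _
  · rw [(hZ m m.pos).map_eq, charFun_gammaMeasure (gammaShape_pos hM m.pos)
      (inv_pos.2 (gammaScale_pos hM m.pos)), inv_inv]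

theorem lintegral_enorm_powerCoefficient_le_one (hM : 1 ≤ M) (hμ : 0 < μ) (mC : Measurable C)
    (mZ : ∀ m, Measurable (Z m)) (hC : HasLaw C (truncPoissonMeasure μ) P)
    (hZ : ∀ m, 1 ≤ m → HasLaw (Z m) (gammaMeasure (gammaShape M m) (gammaScale M m)⁻¹) P)
    (hCZ : IndepFun C (fun ω m => Z m ω) P) :
    ∫⁻ ω, ‖Z (C ω) ω‖ₑ ∂P ≤ 1 := by
  have := isProbabilityMeasure_truncPoissonMeasure hμ
  have mZ' : Measurable fun ω m => Z m ω := measurable_pi_lambda _ mZ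
  have h := lintegral_comp_pair mC mZ' hCZ (f := fun m z => ‖z m‖ₑ)
    measurable_eval_nat_prod.enorm
  simp only at h
  rw [h, hC.map_eq]
  have hae : ∀ᵐ m ∂(truncPoissonMeasure μ), m ≠ 0 := by
    simpa [ae_iff] using truncPoissonMeasure_zero μ
  calc _ ≤ ∫⁻ _, 1 ∂(truncPoissonMeasure μ) := by
        refine lintegral_mono_ae ?_
        filter_upwards [hae] with m hm
        have hm : 1 ≤ m := Nat.one_le_iff_ne_zero.2 hm
        rw [← lintegral_map (f := fun x : ℝ => ‖x‖ₑ) (by fun_prop) (mZ m), (hZ m hm).map_eq,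
          lintegral_enorm_gammaMeasure (gammaShape_pos hM hm) (inv_pos.2 (gammaScale_pos hM hm)),
          div_inv_eq_mul, ← ENNReal.ofReal_one]
        exact ENNReal.ofReal_le_ofReal (gammaShape_mul_gammaScale_le_one hM hm)
    _ = 1 := by simp

theorem norm_charFun_sub_one_le {ν : Measure ℝ} [IsProbabilityMeasure ν]
    (hν : ∫⁻ x, ‖x‖ₑ ∂ν ≤ 1) (s : ℝ) : ‖charFun ν s - 1‖ ≤ |s| := by
  have hi : Integrable (fun x : ℝ => Complex.exp (s * x * Complex.I)) ν := by
    refine Integrable.of_bound (by fun_prop) 1 (ae_of_all _ fun x => ?_)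
    rw [← Complex.ofReal_mul]
    exact (Complex.norm_exp_ofReal_mul_I _).le
  have h1 : charFun ν s - 1 = ∫ x : ℝ, (Complex.exp (s * x * Complex.I) - 1) ∂ν := by
    rw [integral_sub hi (integrable_const 1), charFun_apply_real]
    simp
  have h2 : ‖charFun ν s - 1‖ₑ ≤ ‖s‖ₑ := by
    rw [h1]
    refine (enorm_integral_le_lintegral_enorm _).trans ?_
    calc _ ≤ ∫⁻ x, ‖s‖ₑ * ‖x‖ₑ ∂ν := by
          refine lintegral_mono fun x => ?_
          rw [← enorm_mul, enorm_le_iff_norm_le, ← Complex.ofReal_mul, mul_comm _ Complex.I]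
          exact Real.norm_exp_I_mul_ofReal_sub_one_le
      _ = ‖s‖ₑ * ∫⁻ x, ‖x‖ₑ ∂ν := lintegral_const_mul _ (by fun_prop)
      _ ≤ ‖s‖ₑ * 1 := by gcongr
      _ = ‖s‖ₑ := mul_one _
  rwa [enorm_le_iff_norm_le] at h2

theorem norm_pow_sub_one_le {z : ℂ} (hz : ‖z‖ ≤ 1) (n : ℕ) : ‖z ^ n - 1‖ ≤ n * ‖z - 1‖ := by
  simpa using norm_prod_sub_prod_le_sum (Finset.range n) (f := fun _ => z) (g := fun _ => 1)
    (fun _ => hz) (fun _ => by simp)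

end Mixture

end

section

variable {Ω : Type*} [MeasurableSpace Ω] {P : Measure Ω}

theorem ae_summable_shotNoise {X : ℕ → Ω → Plane}
    {Y : ℕ → Ω → ℝ} {Λ : Measure Plane} [SigmaFinite Λ] {ℓ : Plane → ℝ} (hX : ∀ i, Measurable (X i)) (hY : ∀ i, Measurable (Y i))
    (hN : IsPoissonProcess P (pointProcess X) Λ)
    (hXY : IndepFun (fun ω i => X i ω) (fun ω i => Y i ω) P) {c : ℝ≥0}
    (hc : ∀ i, ∫⁻ ω, ‖Y i ω‖ₑ ∂P ≤ c) (mℓ : Measurable ℓ) (hℓ : Integrable ℓ Λ) :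
    ∀ᵐ ω ∂P, Summable fun i => Y i ω * ℓ (X i ω) := by
  have hfin : ∫⁻ ω, ∑' i, ‖Y i ω * ℓ (X i ω)‖ₑ ∂P ≠ ∞ := by
    have hm (i : ℕ) : Measurable fun ω => ‖Y i ω * ℓ (X i ω)‖ₑ :=
      ((hY i).mul (mℓ.comp (hX i))).enorm
    rw [lintegral_tsum fun i => (hm i).aemeasurable]
    refine ne_top_of_le_ne_top (ENNReal.mul_ne_top (ENNReal.coe_ne_top (r := c)) hℓ.2.ne) ?_
    calc ∑' i, ∫⁻ ω, ‖Y i ω * ℓ (X i ω)‖ₑ ∂P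
        ≤ ∑' i, c * ∫⁻ ω, ‖ℓ (X i ω)‖ₑ ∂P := by
          refine ENNReal.tsum_le_tsum fun i => ?_
          simp_rw [enorm_mul]
          have hi : IndepFun (fun ω => ‖Y i ω‖ₑ) (fun ω => ‖ℓ (X i ω)‖ₑ) P :=
            hXY.symm.comp (φ := fun y : ℕ → ℝ => ‖y i‖ₑ)
              (ψ := fun x : ℕ → Plane => ‖ℓ (x i)‖ₑ) (measurable_pi_apply i).enorm (mℓ.comp (measurable_pi_apply i)).enorm
          have := lintegral_mul_eq_lintegral_mul_lintegral_of_indepFun (hY i).enorm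
            (mℓ.comp (hX i)).enorm hi
          simp only [Pi.mul_apply, Function.comp_apply] at this
          rw [this]
          gcongr
          exact hc i
      _ = c * ∫⁻ x, ‖ℓ x‖ₑ ∂Λ := by
          rw [ENNReal.tsum_mul_left, hN.tsum_lintegral hX mℓ.enorm]
  have hm : Measurable fun ω => ∑' i, ‖Y i ω * ℓ (X i ω)‖ₑ :=
    Measurable.tsum fun i => ((hY i).mul (mℓ.comp (hX i))).enorm
  filter_upwards [ae_lt_top hm hfin] with ω hω
  refine Summable.of_norm ?_
  have h1 := ENNReal.summable_toReal hω.ne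
  simpa using h1

theorem aemeasurable_tsum_shotNoise {X : ℕ → Ω → Plane}
    {Y : ℕ → Ω → ℝ} {ℓ : Plane → ℝ} (hX : ∀ i, Measurable (X i)) (hY : ∀ i, Measurable (Y i))
    (mℓ : Measurable ℓ) (hs : ∀ᵐ ω ∂P, Summable fun i => Y i ω * ℓ (X i ω)) :
    AEMeasurable (fun ω => ∑' i, Y i ω * ℓ (X i ω)) P := by
  refine aemeasurable_of_tendsto_metrizable_ae atTop
    (f := fun n ω => ∑ i ∈ Finset.range n, Y i ω * ℓ (X i ω)) (fun n => ?_) ?_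
  · exact (Finset.measurable_fun_sum _ fun i _ => (hY i).mul (mℓ.comp (hX i))).aemeasurable
  · filter_upwards [hs] with ω hω using hω.hasSum.tendsto_sum_nat

variable [IsProbabilityMeasure P]

section RandomSum

theorem measurable_sum_range_prod :
    Measurable fun q : ℕ × (ℕ → ℝ) => ∑ j ∈ Finset.range q.1, q.2 j :=
  measurable_from_prod_countable_right fun n =>
    Finset.measurable_fun_sum (Finset.range n) fun j _ => measurable_pi_apply j

variable {r : ℝ≥0} {ν : Measure ℝ} {U : Ω → ℕ} {W : ℕ → Ω → ℝ}

theorem charFun_randomSum (mU : Measurable U) (mW : ∀ j, Measurable (W j))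
    (hU : HasLaw U (poissonMeasure r) P) (hW : ∀ j, HasLaw (W j) ν P) (hind : iIndepFun W P)
    (hUW : IndepFun U (fun ω j => W j ω) P) (s : ℝ) :
    charFun (P.map fun ω => ∑ j ∈ Finset.range (U ω), W j ω) s
      = ∫ n, charFun ν s ^ n ∂(poissonMeasure r) := by
  have mW' : Measurable fun ω j => W j ω := measurable_pi_lambda _ mW
  have mS : Measurable fun ω => ∑ j ∈ Finset.range (U ω), W j ω :=
    measurable_sum_range_prod.comp (mU.prodMk mW')
  have h := integral_comp_pair mU mW' hUW (c := 1)
    (f := fun n w => Complex.exp (s * (∑ j ∈ Finset.range n, w j : ℝ) * Complex.I))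
    (Complex.measurable_exp.comp (((Complex.measurable_ofReal.comp
      measurable_sum_range_prod).const_mul _).mul_const _))
    (fun n w => by rw [← Complex.ofReal_mul]; exact (Complex.norm_exp_ofReal_mul_I _).le)
  rw [charFun_apply_real, integral_map mS.aemeasurable (by fun_prop), h, hU.map_eq]
  refine integral_congr_ae (ae_of_all _ fun n => ?_)
  have hn : iIndepFun (fun j : Finset.range n => W j) P := hind.precomp Subtype.val_injective
  have hsplit (ω : Ω) : Complex.exp (s * (∑ j ∈ Finset.range n, W j ω : ℝ) * Complex.I)
      = ∏ j : Finset.range n, Complex.exp (s * W j ω * Complex.I) := by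
    rw [← Complex.exp_sum, Finset.sum_coe_sort (Finset.range n) fun j => (s * W j ω * Complex.I : ℂ),
      Complex.ofReal_sum, Finset.mul_sum, Finset.sum_mul]
  simp only [hsplit]
  rw [hn.integral_fun_prod_comp (f := fun _ x => Complex.exp (s * (x : ℝ) * Complex.I))
    (fun j => (mW j).aemeasurable) (fun j => by fun_prop)]
  have hj (j : ℕ) : ∫ ω, Complex.exp (s * W j ω * Complex.I) ∂P = charFun ν s := by
    rw [← (hW j).map_eq, charFun_apply_real, integral_map (mW j).aemeasurable (by fun_prop)]
  simp [hj]

theorem lintegral_enorm_randomSum_le (mU : Measurable U) (mW : ∀ j, Measurable (W j))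
    (hU : HasLaw U (poissonMeasure r) P) (hW : ∀ j, HasLaw (W j) ν P)
    (hUW : IndepFun U (fun ω j => W j ω) P) (hν : ∫⁻ x, ‖x‖ₑ ∂ν ≤ 1) :
    ∫⁻ ω, ‖∑ j ∈ Finset.range (U ω), W j ω‖ₑ ∂P ≤ r := by
  have mW' : Measurable fun ω j => W j ω := measurable_pi_lambda _ mW
  have h := lintegral_comp_pair mU mW' hUW (f := fun n w => ‖∑ j ∈ Finset.range n, w j‖ₑ)
    measurable_sum_range_prod.enorm
  simp only at h
  rw [h, hU.map_eq, ← lintegral_natCast_poissonMeasure]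
  refine lintegral_mono fun n => ?_
  calc ∫⁻ ω, ‖∑ j ∈ Finset.range n, W j ω‖ₑ ∂P
      ≤ ∫⁻ ω, ∑ j ∈ Finset.range n, ‖W j ω‖ₑ ∂P := lintegral_mono fun ω => enorm_sum_le _ _
    _ = ∑ j ∈ Finset.range n, ∫⁻ ω, ‖W j ω‖ₑ ∂P :=
        lintegral_finsetSum _ fun j _ => (mW j).enorm
    _ ≤ ∑ j ∈ Finset.range n, 1 := by
        refine Finset.sum_le_sum fun j _ => ?_
        rw [← lintegral_map (f := fun x : ℝ => ‖x‖ₑ) (by fun_prop) (mW j), (hW j).map_eq]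
        exact hν
    _ = n := by simp

end RandomSum

section ShotNoise

variable {X : ℕ → Ω → Plane} {Y : ℕ → Ω → ℝ} {Λ : Measure Plane} [SigmaFinite Λ] {ℓ : Plane → ℝ}

theorem charFun_shotNoise (hX : ∀ i, Measurable (X i)) (hY : ∀ i, Measurable (Y i))
    (hN : IsPoissonProcess P (pointProcess X) Λ) (hYind : iIndepFun Y P)
    (hXY : IndepFun (fun ω i => X i ω) (fun ω i => Y i ω) P)
    (mℓ : Measurable ℓ) (hs : ∀ᵐ ω ∂P, Summable fun i => Y i ω * ℓ (X i ω))
    {φ : ℝ → ℂ} (hφ : ∀ i, charFun (P.map (Y i)) = φ) (t : ℝ)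
    (hint : Integrable (fun x => φ (t * ℓ x) - 1) Λ) :
    charFun (P.map fun ω => ∑' i, Y i ω * ℓ (X i ω)) t
      = Complex.exp (∫ x, (φ (t * ℓ x) - 1) ∂Λ) := by
  set h : Plane → ℝ → ℂ := fun x y => Complex.exp ((t * (y * ℓ x) : ℝ) * Complex.I) with hh
  have hm : Measurable (Function.uncurry h) :=
    Complex.measurable_exp.comp ((Complex.measurable_ofReal.comp
      ((measurable_snd.mul (mℓ.comp measurable_fst)).const_mul t)).mul_const _)
  have key := hN.tendsto_integral_prod_marked hX hY hYind hXY hm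
    (fun x y => (Complex.norm_exp_ofReal_mul_I _).le) (H := fun x => φ (t * ℓ x))
    (fun i x => by
      rw [← hφ i, charFun_apply_real, integral_map (hY i).aemeasurable (by fun_prop)]
      refine integral_congr_ae (ae_of_all _ fun ω => ?_)
      simp only [hh]
      congr 2
      push_cast
      ring) hint
  refine tendsto_nhds_unique ?_ key
  rw [charFun_apply_real, integral_map (aemeasurable_tsum_shotNoise hX hY mℓ hs) (by fun_prop)]
  refine tendsto_integral_of_dominated_convergence (fun _ => 1) (fun n => ?_)
    (integrable_const 1) (fun n => ae_of_all _ fun ω => norm_prod_le_one _ fun i =>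
      (Complex.norm_exp_ofReal_mul_I _).le) ?_
  · exact (Finset.measurable_fun_prod _ fun i _ =>
      hm.comp ((hX i).prodMk (hY i))).aestronglyMeasurable
  · filter_upwards [hs] with ω hω
    have h1 := ((hω.hasSum.tendsto_sum_nat.const_mul t).ofReal).mul_const Complex.I
    have h2 := (Complex.continuous_exp.tendsto _).comp h1
    simp only [Complex.ofReal_mul] at h2
    refine h2.congr fun n => ?_
    simp only [hh, Function.comp_apply]
    rw [← Complex.exp_sum, ← Finset.sum_mul, ← Complex.ofReal_sum, ← Finset.mul_sum]
    push_cast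
    rfl

end ShotNoise

section OuterRegion

variable {ν : Measure ℝ} [IsProbabilityMeasure ν]

theorem norm_charFun_pow_sub_one_le (hν : ∫⁻ x, ‖x‖ₑ ∂ν ≤ 1) (s : ℝ) (n : ℕ) :
    ‖charFun ν s ^ n - 1‖ ≤ n * |s| :=
  (norm_pow_sub_one_le (norm_charFun_le_one s) n).trans
    (mul_le_mul_of_nonneg_left (norm_charFun_sub_one_le hν s) n.cast_nonneg)

theorem measurable_charFun_mul_rpow_norm (α t : ℝ) :
    Measurable fun x : Plane => charFun ν (t * ‖x‖ ^ (-α)) :=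
  continuous_charFun.measurable.comp (by fun_prop)

variable {α r₁ : ℝ}

theorem integrable_charFun_pow_sub_one (hr₁ : 0 < r₁) (hα : 2 < α) (hν : ∫⁻ x, ‖x‖ₑ ∂ν ≤ 1)
    (lam t : ℝ) (n : ℕ) :
    Integrable (fun x : Plane => charFun ν (t * ‖x‖ ^ (-α)) ^ n - 1)
      (homogeneous lam (outerRegion r₁)) := by
  refine Integrable.mono' (((integrable_norm_rpow_neg hr₁ hα).norm.const_mul |t|).const_mul n)
    (((measurable_charFun_mul_rpow_norm α t).pow_const n).sub_const 1).aestronglyMeasurable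
    (ae_of_all _ fun x => ?_)
  rw [Real.norm_eq_abs, ← abs_mul]
  exact norm_charFun_pow_sub_one_le hν _ n

theorem integrableOn_one_sub_charFun_pow_mul (hr₁ : 0 < r₁) (hα : 2 < α)
    (hν : ∫⁻ x, ‖x‖ₑ ∂ν ≤ 1) (t : ℝ) (n : ℕ) :
    IntegrableOn (fun r : ℝ => (1 - charFun ν (t * r ^ (-α)) ^ n) * (r : ℂ)) (Set.Ioi r₁) := by
  have hm : Measurable fun r : ℝ => (1 - charFun ν (t * r ^ (-α)) ^ n) * (r : ℂ) := by
    have : Measurable fun r : ℝ => charFun ν (t * r ^ (-α)) :=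
      continuous_charFun.measurable.comp (by fun_prop)
    fun_prop
  refine Integrable.mono' (((integrableOn_rpow_neg_mul_self hr₁ hα).const_mul |t|).const_mul n)
    hm.aestronglyMeasurable ((ae_restrict_iff' measurableSet_Ioi).2 (ae_of_all _ fun r hr => ?_))
  have hr0 : 0 < r := hr₁.trans hr
  rw [norm_mul, norm_sub_rev, Complex.norm_real, Real.norm_of_nonneg hr0.le]
  calc _ ≤ n * |t * r ^ (-α)| * r := by
        gcongr
        exact norm_charFun_pow_sub_one_le hν _ n
    _ = _ := by
        rw [abs_mul, abs_of_nonneg (Real.rpow_nonneg hr0.le _)]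
        ring

theorem integrable_natCast_poissonMeasure (r : ℝ≥0) :
    Integrable (fun n : ℕ => (n : ℝ)) (poissonMeasure r) := by
  refine ⟨Measurable.of_discrete.aestronglyMeasurable, ?_⟩
  have h := lintegral_natCast_poissonMeasure r
  have he (n : ℕ) : ‖(n : ℝ)‖ₑ = n := by
    rw [← ofReal_norm, Real.norm_natCast, ENNReal.ofReal_natCast]
  simp only [HasFiniteIntegral, he]
  rw [h]
  exact ENNReal.coe_lt_top

theorem integrable_charFun_pow_poissonMeasure (r : ℝ≥0) (s : ℝ) :
    Integrable (fun n : ℕ => charFun ν s ^ n) (poissonMeasure r) := by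
  refine Integrable.of_bound Measurable.of_discrete.aestronglyMeasurable 1
    (ae_of_all _ fun n => ?_)
  rw [norm_pow]
  exact pow_le_one₀ (norm_nonneg _) (norm_charFun_le_one s)

theorem integrable_compound_sub_one (hr₁ : 0 < r₁) (hα : 2 < α) (hν : ∫⁻ x, ‖x‖ₑ ∂ν ≤ 1)
    (r : ℝ≥0) (lam t : ℝ) :
    Integrable (fun x : Plane => (∫ n, charFun ν (t * ‖x‖ ^ (-α)) ^ n ∂(poissonMeasure r)) - 1)
      (homogeneous lam (outerRegion r₁)) := by
  refine Integrable.mono' (((integrable_norm_rpow_neg hr₁ hα).norm.const_mul |t|).const_mul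
    (∫ n : ℕ, (n : ℝ) ∂(poissonMeasure r))) ?_ (ae_of_all _ fun x => ?_)
  · simp_rw [integral_pow_poissonMeasure]
    have := measurable_charFun_mul_rpow_norm (ν := ν) α t
    exact Measurable.aestronglyMeasurable (by fun_prop)
  · have h1 : (∫ n, charFun ν (t * ‖x‖ ^ (-α)) ^ n ∂(poissonMeasure r)) - 1
        = ∫ n, (charFun ν (t * ‖x‖ ^ (-α)) ^ n - 1) ∂(poissonMeasure r) := by
      rw [integral_sub (integrable_charFun_pow_poissonMeasure _ _) (integrable_const 1)]
      simp
    rw [h1, Real.norm_eq_abs, ← abs_mul, ← integral_mul_const]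
    exact norm_integral_le_of_norm_le ((integrable_natCast_poissonMeasure r).mul_const _)
      (ae_of_all _ fun n => norm_charFun_pow_sub_one_le hν _ n)

theorem poissonProb_eq {μ : ℝ} (hμ : 0 ≤ μ) (n : ℕ) :
    poissonProb μ n = Real.exp (-(μ.toNNReal : ℝ)) * (μ.toNNReal : ℝ) ^ n / n.factorial := by
  rw [Real.coe_toNNReal _ hμ, poissonProb]
  ring

theorem hasProd_exp_compound (hr₁ : 0 < r₁) (hα : 2 < α) (hν : ∫⁻ x, ‖x‖ₑ ∂ν ≤ 1)
    {lam μ : ℝ} (hlam : 0 ≤ lam) (hμ : 0 ≤ μ) (t : ℝ) :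
    HasProd (fun n : ℕ+ => Complex.exp
        (-(2 * Real.pi * ((lam * poissonProb μ (n : ℕ) : ℝ) : ℂ) *
          ∫ r in Set.Ioi r₁, (1 - charFun ν (t * r ^ (-α)) ^ (n : ℕ)) * (r : ℂ))))
      (Complex.exp (∫ x : Plane, ((∫ n, charFun ν (t * ‖x‖ ^ (-α)) ^ n
        ∂(poissonMeasure μ.toNNReal)) - 1) ∂(homogeneous lam (outerRegion r₁)))) := by
  set Λ := homogeneous lam (outerRegion r₁) with hΛ
  set F : ℕ → Plane → ℂ := fun n x =>
    (poissonProb μ n : ℂ) * (charFun ν (t * ‖x‖ ^ (-α)) ^ n - 1) with hF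
  have hp (n : ℕ) : 0 ≤ poissonProb μ n := by unfold poissonProb; positivity
  have hFint (n : ℕ) : Integrable (F n) Λ :=
    (integrable_charFun_pow_sub_one hr₁ hα hν lam t n).const_mul _
  have hsum : Summable fun n => ∫ x, ‖F n x‖ ∂Λ := by
    have h1 := integrable_poissonMeasure_iff.1 (integrable_natCast_poissonMeasure μ.toNNReal)
    refine Summable.of_nonneg_of_le (fun n => integral_nonneg fun x => norm_nonneg _) (fun n => ?_)
      (h1.mul_right (∫ x : Plane, |t| * ‖‖x‖ ^ (-α)‖ ∂Λ))
    rw [← poissonProb_eq hμ, ← integral_const_mul]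
    refine integral_mono (hFint n).norm
      (((integrable_norm_rpow_neg hr₁ hα).norm.const_mul |t|).const_mul _) fun x => ?_
    simp only [hF]
    rw [norm_mul, Complex.norm_real, Real.norm_of_nonneg (hp n), mul_assoc]
    refine mul_le_mul_of_nonneg_left ?_ (hp n)
    rw [Real.norm_eq_abs (‖x‖ ^ (-α)), ← abs_mul]
    simpa using norm_charFun_pow_sub_one_le hν (t * ‖x‖ ^ (-α)) n
  have htsum (x : Plane) : ∑' n, F n x
      = (∫ n, charFun ν (t * ‖x‖ ^ (-α)) ^ n ∂(poissonMeasure μ.toNNReal)) - 1 := by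
    have hi := integrable_charFun_pow_poissonMeasure (ν := ν) μ.toNNReal (t * ‖x‖ ^ (-α))
    have h1 := hasSum_integral_poissonMeasure (hi.sub (integrable_const (1 : ℂ)))
    simp only [Pi.sub_apply] at h1
    rw [integral_sub hi (integrable_const 1)] at h1
    simp only [← poissonProb_eq hμ, Complex.real_smul, integral_const, probReal_univ, one_smul]
      at h1
    exact h1.tsum_eq
  have hsum' := hasSum_integral_of_summable_integral_norm hFint hsum
  simp_rw [htsum] at hsum'
  rw [← PNat.coe_injective.hasSum_iff] at hsum'
  · convert! hsum'.cexp using 2 with n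
    congr 1
    simp only [Function.comp_apply, hF]
    rw [integral_const_mul, integral_homogeneous_outerRegion hlam hr₁
      fun r => charFun ν (t * r ^ (-α)) ^ (n : ℕ) - 1]
    have hneg : ∫ r in Set.Ioi r₁, (charFun ν (t * r ^ (-α)) ^ (n : ℕ) - 1) * (r : ℂ)
        = -∫ r in Set.Ioi r₁, (1 - charFun ν (t * r ^ (-α)) ^ (n : ℕ)) * (r : ℂ) := by
      rw [← integral_neg]
      refine integral_congr_ae (ae_of_all _ fun r => ?_)
      simp only
      ring
    rw [hneg]
    push_cast
    ring
  · intro n hn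
    have : n = 0 := by
      by_contra h0
      exact hn ⟨⟨n, Nat.pos_of_ne_zero h0⟩, rfl⟩
    simp [this, hF]

end OuterRegion

end

end CoopNetwork

open CoopNetwork in
theorem proposition5
    {Ω : Type*} [MeasurableSpace Ω] (P : Measure Ω) [IsProbabilityMeasure P]
    (lamR lamU r₀ r₁ α : ℝ) (M : ℕ)
    (hlamR : 0 < lamR) (hlamU : 0 < lamU) (hr₀ : 0 < r₀) (hr₁ : r₀ < r₁) (hα : 2 < α)
    (hM : 1 ≤ M)
    -- the radio heads form a homogeneous Poisson process, `X` enumerates the outer ones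
    (ΨR : Ω → Measure Plane)
    (hΨR : IsPoissonProcess P ΨR (homogeneous lamR Set.univ))
    (X : ℕ → Ω → Plane) (hX : ∀ i, Measurable (X i))
    (hXΨ : ∀ᵐ ω ∂P, (ΨR ω).restrict (outerRegion r₁) = pointProcess X ω)
    -- numbers of users served by the outer radio heads
    (U : ℕ → Ω → ℕ) (hU : ∀ i, Measurable (U i))
    (hUlaw : ∀ i, HasLaw (U i) (poissonMeasure (annulusMean lamU r₀ r₁).toNNReal) P)
    (hUindep : iIndepFun U P)
    -- numbers of radio heads serving these users
    (C : ℕ → ℕ → Ω → ℕ) (hC : ∀ i j, Measurable (C i j))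
    (hClaw : ∀ i j, HasLaw (C i j) (truncPoissonMeasure (annulusMean lamR r₀ r₁)) P)
    (hCindep : iIndepFun (fun (q : ℕ × ℕ) ω => C q.1 q.2 ω) P)
    -- Gamma distributed power coefficients (Mathlib's second parameter is the rate)
    (Z : ℕ → ℕ → ℕ → Ω → ℝ) (hZ : ∀ i j m, Measurable (Z i j m))
    (hZlaw : ∀ i j m, 1 ≤ m →
      HasLaw (Z i j m) (gammaMeasure (gammaShape M m) (gammaScale M m)⁻¹) P)
    (hZindep : iIndepFun (fun (q : ℕ × ℕ) ω (m : ℕ) => Z q.1 q.2 m ω) P)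
    -- the four families `X`, `U`, `C`, `Z` are mutually independent
    (hindepX : IndepFun (fun ω i => X i ω)
      (fun ω => ((fun i => U i ω), (fun i j => C i j ω), (fun i j m => Z i j m ω))) P)
    (hindepU : IndepFun (fun ω i => U i ω)
      (fun ω => ((fun i j => C i j ω), (fun i j m => Z i j m ω))) P)
    (hindepC : IndepFun (fun ω i j => C i j ω) (fun ω i j m => Z i j m ω) P) :
    -- decomposition into independent Poisson processes of densities `λ_R p(n)`
    (∀ᵐ ω ∂P, (ΨR ω).restrict (outerRegion r₁) =
      Measure.sum (fun n : ℕ => subProcess X U n ω)) ∧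
    (∀ n : ℕ, IsPoissonProcess P (subProcess X U n)
      (homogeneous (lamR * poissonProb (annulusMean lamU r₀ r₁) n) (outerRegion r₁))) ∧
    iIndepFun (fun (n : ℕ) ω => subProcess X U n ω) P ∧
    -- the outer interference is an almost surely finite random variable
    (∀ᵐ ω ∂P, Summable (fun i => headInterference α X U C Z ω i)) ∧
    AEMeasurable (outerInterference α X U C Z) P ∧
    -- its characteristic function, with convergence of all the expressions involved
    (∀ t : ℝ,
      (∀ r : ℝ, r₁ < r → Summable (fun m : ℕ+ => mixTerm M lamR r₀ r₁ α t r (m : ℕ))) ∧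
      (∀ n : ℕ, 1 ≤ n →
        IntegrableOn (outerIntegrand M lamR r₀ r₁ α t n) (Set.Ioi r₁)) ∧
      HasProd
        (fun n : ℕ+ => Complex.exp
          (-(2 * Real.pi * ((lamR * poissonProb (annulusMean lamU r₀ r₁) (n : ℕ) : ℝ) : ℂ) *
            ∫ r in Set.Ioi r₁, outerIntegrand M lamR r₀ r₁ α t (n : ℕ) r)))
        (charFun (P.map (outerInterference α X U C Z)) t)) := by
  have hμU : 0 < annulusMean lamU r₀ r₁ := by
    have : 0 < r₁ ^ 2 - r₀ ^ 2 := by nlinarith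
    unfold annulusMean
    positivity
  have hμR : 0 < annulusMean lamR r₀ r₁ := by
    have : 0 < r₁ ^ 2 - r₀ ^ 2 := by nlinarith
    unfold annulusMean
    positivity
  have hr₁0 : 0 < r₁ := hr₀.trans hr₁
  have hprob (n : ℕ) : 0 < poissonProb (annulusMean lamU r₀ r₁) n := by
    unfold poissonProb
    positivity
  -- the outer radio heads
  have hN : IsPoissonProcess P (pointProcess X) (homogeneous lamR (outerRegion r₁)) := by
    have h := (hΨR.restrict (measurableSet_outerRegion r₁)).congr hXΨ
    rwa [homogeneous, Measure.restrict_univ, Measure.restrict_smul] at h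
  have hXU : IndepFun (fun ω i => X i ω) (fun ω i => U i ω) P :=
    hindepX.comp measurable_id measurable_fst
  set W : ℕ → ℕ → Ω → ℝ := fun i j ω => Z i j (C i j ω) ω with hWdef
  have mZ' (i j : ℕ) : Measurable fun ω m => Z i j m ω := measurable_pi_lambda _ (hZ i j)
  have mW (i j : ℕ) : Measurable (W i j) :=
    measurable_eval_nat_prod.comp ((hC i j).prodMk (mZ' i j))
  have hCZ (i j : ℕ) : IndepFun (C i j) (fun ω m => Z i j m ω) P :=
    hindepC.comp (φ := fun c : ℕ → ℕ → ℕ => c i j) (ψ := fun z : ℕ → ℕ → ℕ → ℝ => z i j)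
      (by fun_prop) (by fun_prop)
  set ν := P.map (W 0 0) with hν
  have hνprob : IsProbabilityMeasure ν := Measure.isProbabilityMeasure_map (mW 0 0).aemeasurable
  have hchar (i j : ℕ) (s : ℝ) := hasSum_charFun_powerCoefficient hM hμR (hC i j) (hZ i j)
    (hClaw i j) (hZlaw i j) (hCZ i j) s
  have hWlaw (i j : ℕ) : HasLaw (W i j) ν P := by
    refine ⟨(mW i j).aemeasurable, ?_⟩
    have := Measure.isProbabilityMeasure_map (μ := P) (mW i j).aemeasurable
    exact Measure.ext_of_charFun (funext fun s => (hchar i j s).unique (hchar 0 0 s))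
  have hνmean : ∫⁻ x, ‖x‖ₑ ∂ν ≤ 1 := by
    rw [hν, lintegral_map (by fun_prop) (mW 0 0)]
    exact lintegral_enorm_powerCoefficient_le_one (C := C 0 0) (Z := Z 0 0) hM hμR (hC 0 0) (hZ 0 0)
      (hClaw 0 0) (hZlaw 0 0) (hCZ 0 0)
  have hWind : iIndepFun (fun (q : ℕ × ℕ) ω => W q.1 q.2 ω) P := by
    have hpair : iIndepFun (fun (q : ℕ × ℕ) ω => (C q.1 q.2 ω, fun m => Z q.1 q.2 m ω)) P := by
      refine iIndepFun_prodMk (fun q => hC _ _) (fun q => mZ' _ _) hCindep hZindep ?_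
      exact hindepC.comp (φ := fun (c : ℕ → ℕ → ℕ) (q : ℕ × ℕ) => c q.1 q.2)
        (ψ := fun (z : ℕ → ℕ → ℕ → ℝ) (q : ℕ × ℕ) => z q.1 q.2) (by fun_prop) (by fun_prop)
    exact hpair.comp (fun _ q => q.2 q.1) fun _ => measurable_eval_nat_prod
  have hWrow : iIndepFun (fun i ω j => W i j ω) P :=
    iIndepFun_curry (fun q => mW q.1 q.2) hWind
  have mpick : Measurable fun (p : (ℕ → ℕ → ℕ) × (ℕ → ℕ → ℕ → ℝ)) (i j : ℕ) =>
      p.2 i j (p.1 i j) := by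
    refine measurable_pi_lambda _ fun i => measurable_pi_lambda _ fun j => ?_
    have m1 : Measurable fun p : (ℕ → ℕ → ℕ) × (ℕ → ℕ → ℕ → ℝ) => (p.1 i j, p.2 i j) := by
      fun_prop
    exact measurable_eval_nat_prod.comp m1
  have hUW : IndepFun (fun ω i => U i ω) (fun ω i j => W i j ω) P :=
    hindepU.comp measurable_id mpick
  -- the total power sent by a radio head
  set Y : ℕ → Ω → ℝ := fun i ω => ∑ j ∈ Finset.range (U i ω), W i j ω with hYdef
  have mWrow (i : ℕ) : Measurable fun ω j => W i j ω := measurable_pi_lambda _ (mW i)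
  have mY (i : ℕ) : Measurable (Y i) := measurable_sum_range_prod.comp ((hU i).prodMk (mWrow i))
  have hYind : iIndepFun Y P :=
    (iIndepFun_prodMk hU mWrow hUindep hWrow hUW).comp
      (fun _ q => ∑ j ∈ Finset.range q.1, q.2 j) fun _ => measurable_sum_range_prod
  have hXY : IndepFun (fun ω i => X i ω) (fun ω i => Y i ω) P := by
    have m : Measurable fun (p : (ℕ → ℕ) × (ℕ → ℕ → ℕ) × (ℕ → ℕ → ℕ → ℝ)) (i : ℕ) =>
        ∑ j ∈ Finset.range (p.1 i), p.2.2 i j (p.2.1 i j) := by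
      refine measurable_pi_lambda _ fun i => ?_
      have m1 : Measurable fun p : (ℕ → ℕ) × (ℕ → ℕ → ℕ) × (ℕ → ℕ → ℕ → ℝ) =>
          (p.1 i, fun j => p.2.2 i j (p.2.1 i j)) := by
        refine Measurable.prodMk (by fun_prop) ?_
        exact (measurable_pi_apply i).comp (mpick.comp measurable_snd)
      exact measurable_sum_range_prod.comp m1
    exact hindepX.comp measurable_id m
  have hWcol (i : ℕ) : iIndepFun (W i) P :=
    hWind.precomp (g := fun j => (i, j)) fun j j' h => (Prod.ext_iff.1 h).2
  have hUWi (i : ℕ) : IndepFun (U i) (fun ω j => W i j ω) P :=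
    hUW.comp (measurable_pi_apply i) (measurable_pi_apply i)
  have hYmean (i : ℕ) : ∫⁻ ω, ‖Y i ω‖ₑ ∂P ≤ ((annulusMean lamU r₀ r₁).toNNReal : ℝ≥0∞) :=
    lintegral_enorm_randomSum_le (hU i) (mW i) (hUlaw i) (hWlaw i) (hUWi i) hνmean
  have hYchar (i : ℕ) : charFun (P.map (Y i))
      = fun s => ∫ n, charFun ν s ^ n ∂(poissonMeasure (annulusMean lamU r₀ r₁).toNNReal) :=
    funext fun s => charFun_randomSum (hU i) (mW i) (hUlaw i) (hWlaw i) (hWcol i) (hUWi i) s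
  have mℓ : Measurable fun x : Plane => ‖x‖ ^ (-α) := by fun_prop
  have hhead : headInterference α X U C Z = fun ω i => Y i ω * ‖X i ω‖ ^ (-α) := by
    funext ω i
    rw [headInterference, hYdef, Finset.sum_mul]
  have hout : outerInterference α X U C Z = fun ω => ∑' i, Y i ω * ‖X i ω‖ ^ (-α) := by
    funext ω
    rw [outerInterference, hhead]
  have hsummable := ae_summable_shotNoise hX mY hN hXY hYmean mℓ
    (integrable_norm_rpow_neg hr₁0 hα)
  refine ⟨?_, fun n => ?_, iIndepFun_subProcess hX hU hN hUlaw hUindep hXU, ?_, ?_, fun t => ?_⟩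
  · filter_upwards [hXΨ] with ω hω
    rw [hω, sum_subProcess]
  · have hκ : poissonMeasure (annulusMean lamU r₀ r₁).toNNReal {n}
        = ENNReal.ofReal (poissonProb (annulusMean lamU r₀ r₁) n) := by
      rw [poissonMeasure_singleton, poissonProb_eq hμU.le]
    have h := isPoissonProcess_subProcess hX hU hN hUlaw hUindep hXU n
      (by rw [hκ]; exact (ENNReal.ofReal_pos.2 (hprob n)).ne')
    rwa [hκ, homogeneous, smul_smul, ← ENNReal.ofReal_mul (hprob n).le, mul_comm] at h
  · rw [hhead]
    exact hsummable
  · rw [hout]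
    exact aemeasurable_tsum_shotNoise hX mY mℓ hsummable
  · have hmix (r : ℝ) : HasSum (fun m : ℕ+ => mixTerm M lamR r₀ r₁ α t r (m : ℕ))
        (charFun ν (t * r ^ (-α))) := hchar 0 0 (t * r ^ (-α))
    have hintegrand (n : ℕ) : outerIntegrand M lamR r₀ r₁ α t n
        = fun r => (1 - charFun ν (t * r ^ (-α)) ^ n) * (r : ℂ) := by
      funext r
      rw [outerIntegrand, (hmix r).tsum_eq]
    refine ⟨fun r _ => (hmix r).summable, fun n _ => ?_, ?_⟩
    · rw [hintegrand]
      exact integrableOn_one_sub_charFun_pow_mul hr₁0 hα hνmean t n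
    · simp_rw [hintegrand]
      rw [hout, charFun_shotNoise hX mY hN hYind hXY mℓ hsummable hYchar t
        (integrable_compound_sub_one hr₁0 hα hνmean _ lamR t)]
      exact hasProd_exp_compound hr₁0 hα hνmean hlamR.le hμU.le t
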